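/- All manifolds are finite dimensional, Hausdorff, second countable, without boundary, and all objects are smooth ($C^\infty$). **Setting.** A *discrete tangent bundle* of a manifold $\mathcal Q$ is a manifold $\mathcal V$ with $\dim\mathcal V=2\dim\mathcal Q$ together with submersions $\partial^+,\partial^-\colon\mathcal V\to\mathcal Q$ such that $\ker T\partial^+\cap\ker T\partial^-=0$ and such that for every $q\in\mathcal Q$ there is exactly one $v\in\mathcal V$ with $\partial^+(v)=\partial^-(v)=q$. Then $T_v\mathcal V=\ker T_v\partial^-\oplus\ker T_v\partial^+$; write $\delta v=\delta v^++\delta v^-$ for the corresponding decomposition, $\delta v^+\in\ker T_v\partial^-$, $\delta v^-\in\ker T_v\partial^+$. A *discrete constrained Lagrangian system* (DCLS) $(\mathcal V,\partial^+,\partial^-,\sigma_d,\mathcal D_d,\mathcal E_d)$ consists of a discrete tangent bundle of $\mathcal Q$, a one form $\sigma_d$ on $\mathcal V$, an (embedded) submanifold $\mathcal D_d\subseteq\mathcal V$ such that $\partial^+|\mathcal D_d$ and $\partial^-|\mathcal D_d$ are submersions, and a smooth subbundle $\mathcal E_d$ of the pull-back bundle $(\partial^+|\mathcal D_d)^*(T\mathcal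 Q)$. A pair $v,\tilde v\in\mathcal D_d$ is a *solution pair* if $\partial^+(v)=\partial^-(\tilde v)$ and $\sigma_d(v)\,\delta v+\sigma_d(\tilde v)\,\delta\tilde v=0$ for all $\delta v\in T_v\mathcal V$, $\delta\tilde v\in T_{\tilde v}\mathcal V$ with $T\partial^+(\delta v)=T\partial^-(\delta\tilde v)\in(\mathcal E_d)_v$, $T\partial^-(\delta v)=0$ and $T\partial^+(\delta\tilde v)=0$. An *evolution map* is a smooth map $F\colon U_F\to V_F$, with $U_F$ an open subset of $\mathcal D_d$ and $V_F\subseteq\mathcal D_d$, such that $(v,F(v))$ is a solution pair for all $v\in U_F$. Set $\theta^+(v)\,\delta v=\sigma_d(v)\,\delta v^+$, $\theta^-(v)\,\delta v=-\sigma_d(v)\,\delta v^-$, $\omega^\pm=-d\theta^\pm$. The DCLS is *holonomic*, with constraint distribution $\mathcal D_d^{\mathcal Q}$, if $d\sigma_d=0$ and $\mathcal D_d^{\mathcal Q}$ is an involutive smooth distribution (subbundle of $T\mathcal Q$) such that $(\mathcal E_d)_v=(\mathcal D_d^{\mathcal Q})_{\partial^+(v)}$ for all $v\in\mathcal D_d$;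 for all $v\in\mathcal D_d$ the points $\partial^-(v)$ and $\partial^+(v)$ are joined by a piecewise smooth curve with derivative in $\mathcal D_d^{\mathcal Q}$; and $\dim\mathcal D_d=\dim\mathcal D_d^{\mathcal Q}$, i.e. $\dim\mathcal D_d$ is $\dim\mathcal Q$ plus the fiber dimension of $\mathcal D_d^{\mathcal Q}$. For $v\in\mathcal D_d$ put $$(\mathcal K^0_{\mathcal D_d})_v=\{\delta v\in T_v\mathcal V : T\partial^-(\delta v)\in(\mathcal D_d^{\mathcal Q})_{\partial^-(v)},\ T\partial^+(\delta v)\in(\mathcal D_d^{\mathcal Q})_{\partial^+(v)}\}.$$ **Corollary.** Let $F\colon U_F\to V_F$ be an evolution map of a holonomic DCLS. Then $\omega^+=\omega^-$; denote the common value by $\omega_d$. Moreover $(\mathcal K^0_{\mathcal D_d})_v\subseteq T_v\mathcal D_d$ for all $v\in\mathcal D_d$, and $F$ is symplectic on $\mathcal K^0_{\mathcal D_d}$, i.e. for all $v\in U_F$ and all $\delta v,\delta w\in(\mathcal K^0_{\mathcal D_d})_v$, $$TF(\delta v)\in(\mathcal K^0_{\mathcal D_d})_{F(v)}\quad\text{and}\quad\omega_d(F(v))\bigl(TF(\delta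 v),TF(\delta w)\bigr)=\omega_d(v)(\delta v,\delta w).$$ -/

import Mathlib

open scoped Manifold ContDiff Topology

noncomputable section

namespace DiscreteMechanics

/-! Conventions: manifolds are smooth, without boundary, modelled on a finite dimensional real normed
space `E` through `𝓘(ℝ, E)`; the dimension of the manifold is `Module.finrank ℝ E`. -/

section Manifolds

variable {E : Type*} [NormedAddCommGroup E] [NormedSpace ℝ E]
  {M : Type*} [TopologicalSpace M] [ChartedSpace E M] [IsManifold 𝓘(ℝ, E) ∞ M]
  {E' : Type*} [NormedAddCommGroup E'] [NormedSpace ℝ E']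
  {N : Type*} [TopologicalSpace N] [ChartedSpace E' N] [IsManifold 𝓘(ℝ, E') ∞ N]

/-- The one form `θ` on `M` is smooth: it is a smooth section of the cotangent bundle. -/
def IsSmoothOneForm (θ : ∀ m : M, TangentSpace 𝓘(ℝ, E) m →L[ℝ] ℝ) : Prop :=
  ContMDiff 𝓘(ℝ, E) (𝓘(ℝ, E).prod 𝓘(ℝ, E →L[ℝ] ℝ)) ∞
    (fun m ↦ Bundle.TotalSpace.mk' (E →L[ℝ] ℝ)
      (E := fun m : M ↦ TangentSpace 𝓘(ℝ, E) m →L[ℝ] ℝ) m (θ m))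

/-- The local representative of the one form `θ` in the preferred chart at `m₀`: the pull-back of
`θ` by the inverse of the chart, a one form on the model space. -/
def oneFormInChart (θ : ∀ m : M, TangentSpace 𝓘(ℝ, E) m →L[ℝ] ℝ) (m₀ : M) (x : E) : E →L[ℝ] ℝ :=
  (θ ((extChartAt 𝓘(ℝ, E) m₀).symm x)).comp
    (mfderiv 𝓘(ℝ, E) 𝓘(ℝ, E) (extChartAt 𝓘(ℝ, E) m₀).symm x)

/-- The exterior derivative `dθ(m)(a, b)` of a (smooth) one form, computed in the preferred chart at
`m`, where it is `Dθ(x)(a)(b) - Dθ(x)(b)(a)`. The normalization is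
`dθ(X, Y) = X(θ(Y)) - Y(θ(X)) - θ([X, Y])`. -/
def dOneForm (θ : ∀ m : M, TangentSpace 𝓘(ℝ, E) m →L[ℝ] ℝ) (m : M)
    (a b : TangentSpace 𝓘(ℝ, E) m) : ℝ :=
  let a' : E := mfderiv 𝓘(ℝ, E) 𝓘(ℝ, E) (extChartAt 𝓘(ℝ, E) m) m a
  let b' : E := mfderiv 𝓘(ℝ, E) 𝓘(ℝ, E) (extChartAt 𝓘(ℝ, E) m) m b
  let Dθ : E →L[ℝ] E →L[ℝ] ℝ := fderiv ℝ (oneFormInChart θ m) (extChartAt 𝓘(ℝ, E) m m)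
  Dθ a' b' - Dθ b' a'

/-- `A` is a smooth subbundle of the pull-back bundle `f^*(TN)`, i.e. a smooth assignment of
subspaces `A x ⊆ T_{f(x)}N` to the points `x` of `M`: near every point of `M` it is spanned by a
smooth frame. -/
def IsSubbundleAlong (f : M → N) (A : ∀ x : M, Submodule ℝ (TangentSpace 𝓘(ℝ, E') (f x))) : Prop :=
  ∀ x₀ : M, ∃ (k : ℕ) (u : Set M) (X : Fin k → ∀ x : M, TangentSpace 𝓘(ℝ, E') (f x)),
    IsOpen u ∧ x₀ ∈ u ∧
    (∀ i, ContMDiffOn 𝓘(ℝ, E) 𝓘(ℝ, E').tangent ∞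
      (fun x ↦ (⟨f x, X i x⟩ : TangentBundle 𝓘(ℝ, E') N)) u) ∧
    ∀ x ∈ u, LinearIndependent ℝ (fun i ↦ X i x) ∧
      Submodule.span ℝ (Set.range fun i ↦ X i x) = A x

/-- A smooth distribution on `M`, i.e. a smooth subbundle of `TM`. -/
def IsDistribution (Δ : ∀ m : M, Submodule ℝ (TangentSpace 𝓘(ℝ, E) m)) : Prop :=
  IsSubbundleAlong (E := E) (E' := E) (fun m : M ↦ m) Δ

/-- The distribution `Δ` is involutive: the Lie bracket of any two smooth (local) vector fields with
values in `Δ` has values in `Δ`. -/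
def IsInvolutive (Δ : ∀ m : M, Submodule ℝ (TangentSpace 𝓘(ℝ, E) m)) : Prop :=
  ∀ (u : Set M) (X Y : ∀ m : M, TangentSpace 𝓘(ℝ, E) m), IsOpen u →
    ContMDiffOn 𝓘(ℝ, E) 𝓘(ℝ, E).tangent ∞ (fun m ↦ (⟨m, X m⟩ : TangentBundle 𝓘(ℝ, E) M)) u →
    ContMDiffOn 𝓘(ℝ, E) 𝓘(ℝ, E).tangent ∞ (fun m ↦ (⟨m, Y m⟩ : TangentBundle 𝓘(ℝ, E) M)) u →
    (∀ m ∈ u, X m ∈ Δ m) → (∀ m ∈ u, Y m ∈ Δ m) →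
    ∀ m ∈ u, VectorField.mlieBracket 𝓘(ℝ, E) X Y m ∈ Δ m

/-- `m'` is `Δ`-reachable from `m`: there are a curve `c` on `[a, b]` from `m` to `m'` and a
partition `a = t 0 < t 1 < ⋯ < t n = b` such that, on every `[t i, t (i + 1)]`, the curve is smooth
with derivative in `Δ`. -/
def Reachable (Δ : ∀ m : M, Submodule ℝ (TangentSpace 𝓘(ℝ, E) m)) (m m' : M) : Prop :=
  ∃ (c : ℝ → M) (n : ℕ) (t : ℕ → ℝ), c (t 0) = m ∧ c (t n) = m' ∧
    ∀ i < n, t i < t (i + 1) ∧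
      ContMDiffOn 𝓘(ℝ, ℝ) 𝓘(ℝ, E) ∞ c (Set.Icc (t i) (t (i + 1))) ∧
      ∀ s ∈ Set.Icc (t i) (t (i + 1)),
        mfderivWithin 𝓘(ℝ, ℝ) 𝓘(ℝ, E) c (Set.Icc (t i) (t (i + 1))) s (1 : ℝ) ∈ Δ (c s)

end Manifolds

section Systems

variable (EQ : Type*) [NormedAddCommGroup EQ] [NormedSpace ℝ EQ]
  (Q : Type*) [TopologicalSpace Q] [ChartedSpace EQ Q] [IsManifold 𝓘(ℝ, EQ) ∞ Q]
  (EV : Type*) [NormedAddCommGroup EV] [NormedSpace ℝ EV]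
  (V : Type*) [TopologicalSpace V] [ChartedSpace EV V] [IsManifold 𝓘(ℝ, EV) ∞ V]
  (ED : Type*) [NormedAddCommGroup ED] [NormedSpace ℝ ED]
  (D : Type*) [TopologicalSpace D] [ChartedSpace ED D] [IsManifold 𝓘(ℝ, ED) ∞ D]

/-- A discrete tangent bundle `(V, ∂⁺, ∂⁻)` of `Q`. -/
structure DiscreteTangentBundle where
  /-- the boundary map `∂⁺` -/
  bdPlus : V → Q
  /-- the boundary map `∂⁻` -/
  bdMinus : V → Q
  finrank_eq : Module.finrank ℝ EV = 2 * Module.finrank ℝ EQ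
  contMDiff_bdPlus : ContMDiff 𝓘(ℝ, EV) 𝓘(ℝ, EQ) ∞ bdPlus
  contMDiff_bdMinus : ContMDiff 𝓘(ℝ, EV) 𝓘(ℝ, EQ) ∞ bdMinus
  surjective_bdPlus : ∀ v, Function.Surjective (mfderiv 𝓘(ℝ, EV) 𝓘(ℝ, EQ) bdPlus v)
  surjective_bdMinus : ∀ v, Function.Surjective (mfderiv 𝓘(ℝ, EV) 𝓘(ℝ, EQ) bdMinus v)
  ker_inf_ker : ∀ v, (mfderiv 𝓘(ℝ, EV) 𝓘(ℝ, EQ) bdPlus v).ker ⊓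
    (mfderiv 𝓘(ℝ, EV) 𝓘(ℝ, EQ) bdMinus v).ker = ⊥
  existsUnique_zero : ∀ q, ∃! v, bdPlus v = q ∧ bdMinus v = q

/-- A discrete constrained Lagrangian system `(V, ∂⁺, ∂⁻, σ, D, A)` on `Q`. The constraint
submanifold is a manifold `D` with a smooth embedding `incl : D → V`, and `A` is the subbundle of
`(∂⁺|D)^*(TQ)` of admissible variations. -/
structure DCLS extends DiscreteTangentBundle EQ Q EV V where
  /-- the discrete Lagrangian one form `σ` on `V` -/
  sigma : ∀ v : V, TangentSpace 𝓘(ℝ, EV) v →L[ℝ] ℝ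
  smooth_sigma : IsSmoothOneForm sigma
  /-- the inclusion of the constraint submanifold -/
  incl : D → V
  contMDiff_incl : ContMDiff 𝓘(ℝ, ED) 𝓘(ℝ, EV) ∞ incl
  injective_incl : ∀ x, Function.Injective (mfderiv 𝓘(ℝ, ED) 𝓘(ℝ, EV) incl x)
  isEmbedding_incl : Topology.IsEmbedding incl
  surjective_bdPlus_incl : ∀ x,
    Function.Surjective (mfderiv 𝓘(ℝ, ED) 𝓘(ℝ, EQ) (bdPlus ∘ incl) x)
  surjective_bdMinus_incl : ∀ x,
    Function.Surjective (mfderiv 𝓘(ℝ, ED) 𝓘(ℝ, EQ) (bdMinus ∘ incl) x)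
  /-- the subspaces `A x ⊆ T_{∂⁺(x)}Q`, `x ∈ D`, of the variations -/
  variations : ∀ x : D, Submodule ℝ (TangentSpace 𝓘(ℝ, EQ) (bdPlus (incl x)))
  isSubbundle_variations :
    IsSubbundleAlong (E := ED) (E' := EQ) (fun x ↦ bdPlus (incl x)) variations

end Systems

variable {EQ : Type*} [NormedAddCommGroup EQ] [NormedSpace ℝ EQ] [FiniteDimensional ℝ EQ]
  {Q : Type*} [TopologicalSpace Q] [ChartedSpace EQ Q] [IsManifold 𝓘(ℝ, EQ) ∞ Q]
  {EV : Type*} [NormedAddCommGroup EV] [NormedSpace ℝ EV] [FiniteDimensional ℝ EV]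
  {V : Type*} [TopologicalSpace V] [ChartedSpace EV V] [IsManifold 𝓘(ℝ, EV) ∞ V]
  {ED : Type*} [NormedAddCommGroup ED] [NormedSpace ℝ ED]
  {D : Type*} [TopologicalSpace D] [ChartedSpace ED D] [IsManifold 𝓘(ℝ, ED) ∞ D]

namespace DiscreteTangentBundle

/-- `T_v∂⁺` -/
abbrev tPlus (B : DiscreteTangentBundle EQ Q EV V) (v : V) :
    TangentSpace 𝓘(ℝ, EV) v →L[ℝ] TangentSpace 𝓘(ℝ, EQ) (B.bdPlus v) :=
  mfderiv 𝓘(ℝ, EV) 𝓘(ℝ, EQ) B.bdPlus v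

/-- `T_v∂⁻` -/
abbrev tMinus (B : DiscreteTangentBundle EQ Q EV V) (v : V) :
    TangentSpace 𝓘(ℝ, EV) v →L[ℝ] TangentSpace 𝓘(ℝ, EQ) (B.bdMinus v) :=
  mfderiv 𝓘(ℝ, EV) 𝓘(ℝ, EQ) B.bdMinus v

/-- `T_vV = ker T_v∂⁻ ⊕ ker T_v∂⁺` -/
theorem isCompl_ker (B : DiscreteTangentBundle EQ Q EV V) (v : V) :
    IsCompl (B.tMinus v).ker (B.tPlus v).ker := by
  have key : ∀ f g : EV →ₗ[ℝ] EQ, Function.Surjective f → Function.Surjective g →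
      LinearMap.ker f ⊓ LinearMap.ker g = ⊥ → IsCompl (LinearMap.ker g) (LinearMap.ker f) := by
    intro f g hf hg h
    have h1 := LinearMap.finrank_range_add_finrank_ker f
    have h2 := LinearMap.finrank_range_add_finrank_ker g
    rw [LinearMap.range_eq_top.2 hf, finrank_top] at h1
    rw [LinearMap.range_eq_top.2 hg, finrank_top] at h2
    have h3 := B.finrank_eq
    exact (Submodule.isCompl_iff_disjoint (LinearMap.ker g) (LinearMap.ker f) (by omega)).2
      (disjoint_iff.2 ((inf_comm (LinearMap.ker g) (LinearMap.ker f)).trans h))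
  exact key _ _ (B.surjective_bdPlus v) (B.surjective_bdMinus v) (B.ker_inf_ker v)

/-- The part `δv⁺ ∈ ker T∂⁻` of `δv = δv⁺ + δv⁻`, as a linear map of `δv`. -/
def plusPart (B : DiscreteTangentBundle EQ Q EV V) (v : V) :
    TangentSpace 𝓘(ℝ, EV) v →ₗ[ℝ] TangentSpace 𝓘(ℝ, EV) v :=
  (B.tMinus v).ker.projection (B.tPlus v).ker (B.isCompl_ker v)

/-- The part `δv⁻ ∈ ker T∂⁺` of `δv = δv⁺ + δv⁻`, as a linear map of `δv`. -/
def minusPart (B : DiscreteTangentBundle EQ Q EV V) (v : V) :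
    TangentSpace 𝓘(ℝ, EV) v →ₗ[ℝ] TangentSpace 𝓘(ℝ, EV) v :=
  (B.tPlus v).ker.projection (B.tMinus v).ker (B.isCompl_ker v).symm

end DiscreteTangentBundle

namespace DCLS

/-- The one form `θ⁺(v)(δv) = σ(v)(δv⁺)` on `V`. -/
def thetaPlus (S : DCLS EQ Q EV V ED D) (v : V) : TangentSpace 𝓘(ℝ, EV) v →L[ℝ] ℝ :=
  haveI : FiniteDimensional ℝ (TangentSpace 𝓘(ℝ, EV) v) := inferInstanceAs (FiniteDimensional ℝ EV)
  haveI : T2Space (TangentSpace 𝓘(ℝ, EV) v) := inferInstanceAs (T2Space EV)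
  LinearMap.toContinuousLinearMap ((S.sigma v).toLinearMap ∘ₗ S.plusPart v)

/-- The one form `θ⁻(v)(δv) = -σ(v)(δv⁻)` on `V`. -/
def thetaMinus (S : DCLS EQ Q EV V ED D) (v : V) : TangentSpace 𝓘(ℝ, EV) v →L[ℝ] ℝ :=
  haveI : FiniteDimensional ℝ (TangentSpace 𝓘(ℝ, EV) v) := inferInstanceAs (FiniteDimensional ℝ EV)
  haveI : T2Space (TangentSpace 𝓘(ℝ, EV) v) := inferInstanceAs (T2Space EV)
  LinearMap.toContinuousLinearMap (-((S.sigma v).toLinearMap ∘ₗ S.minusPart v))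

/-- The two form `ω⁺ = -dθ⁺` on `V`. -/
def omegaPlus (S : DCLS EQ Q EV V ED D) (v : V) (δv δw : TangentSpace 𝓘(ℝ, EV) v) : ℝ :=
  -dOneForm S.thetaPlus v δv δw

/-- The two form `ω⁻ = -dθ⁻` on `V`. -/
def omegaMinus (S : DCLS EQ Q EV V ED D) (v : V) (δv δw : TangentSpace 𝓘(ℝ, EV) v) : ℝ :=
  -dOneForm S.thetaMinus v δv δw

/-- `(x, y)` is a solution pair: it satisfies the discrete Lagrange-d'Alembert principle for
sequences of length two. -/
def IsSolutionPair (S : DCLS EQ Q EV V ED D) (x y : D) : Prop :=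
  S.bdPlus (S.incl x) = S.bdMinus (S.incl y) ∧
  ∀ (δv : TangentSpace 𝓘(ℝ, EV) (S.incl x)) (δw : TangentSpace 𝓘(ℝ, EV) (S.incl y)),
    S.tPlus (S.incl x) δv ∈ S.variations x →
    S.tMinus (S.incl x) δv = 0 → S.tPlus (S.incl y) δw = 0 →
    (⟨S.bdPlus (S.incl x), S.tPlus (S.incl x) δv⟩ : TangentBundle 𝓘(ℝ, EQ) Q) =
      ⟨S.bdMinus (S.incl y), S.tMinus (S.incl y) δw⟩ →
    S.sigma (S.incl x) δv + S.sigma (S.incl y) δw = 0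

/-- `F : U → U'` is an evolution map of the system: it is a smooth map, with open domain `U`, of the
constraint submanifold, and `(x, F x)` is a solution pair for all `x ∈ U`. -/
structure IsEvolutionMap (S : DCLS EQ Q EV V ED D) (F : D → D) (U U' : Set D) : Prop where
  isOpen_dom : IsOpen U
  mapsTo : Set.MapsTo F U U'
  contMDiffOn : ContMDiffOn 𝓘(ℝ, ED) 𝓘(ℝ, ED) ∞ F U
  isSolutionPair : ∀ x ∈ U, S.IsSolutionPair x (F x)

/-- The system has linear constraints, provided by the distribution `Δ` on `Q`. The last condition
is `dim D = dim Δ`, where `Δ` is regarded as a submanifold of `TQ`. -/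
structure HasLinearConstraints (S : DCLS EQ Q EV V ED D)
    (Δ : ∀ q : Q, Submodule ℝ (TangentSpace 𝓘(ℝ, EQ) q)) : Prop where
  isDistribution : IsDistribution Δ
  variations_eq : ∀ x, S.variations x = Δ (S.bdPlus (S.incl x))
  reachable : ∀ x, Reachable Δ (S.bdMinus (S.incl x)) (S.bdPlus (S.incl x))
  finrank_eq : ∀ q, Module.finrank ℝ ED = Module.finrank ℝ EQ + Module.finrank ℝ (Δ q)

/-- The system is holonomic, with constraint distribution `Δ`. -/
structure IsHolonomic (S : DCLS EQ Q EV V ED D)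
    (Δ : ∀ q : Q, Submodule ℝ (TangentSpace 𝓘(ℝ, EQ) q)) : Prop
    extends S.HasLinearConstraints Δ where
  isInvolutive : IsInvolutive Δ
  closed_sigma : ∀ v δv δw, dOneForm S.sigma v δv δw = 0

/-- The distribution `K⁰ = ((T∂⁻)⁻¹Δ ∩ (T∂⁺)⁻¹Δ)|D`, made of tangent vectors of `V` at points
of `D`. -/
def K0 (S : DCLS EQ Q EV V ED D) (Δ : ∀ q : Q, Submodule ℝ (TangentSpace 𝓘(ℝ, EQ) q)) (x : D) :
    Submodule ℝ (TangentSpace 𝓘(ℝ, EV) (S.incl x)) :=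
  (Δ (S.bdMinus (S.incl x))).comap (S.tMinus (S.incl x)).toLinearMap ⊓
    (Δ (S.bdPlus (S.incl x))).comap (S.tPlus (S.incl x)).toLinearMap

/-- The tangent map of the inclusion of the constraint submanifold. -/
abbrev tIncl (S : DCLS EQ Q EV V ED D) (x : D) :
    TangentSpace 𝓘(ℝ, ED) x →L[ℝ] TangentSpace 𝓘(ℝ, EV) (S.incl x) :=
  mfderiv 𝓘(ℝ, ED) 𝓘(ℝ, EV) S.incl x

end DCLS

end DiscreteMechanics

end

set_option linter.unusedSectionVars false

noncomputable section

namespace DiscreteMechanics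

/-! ### Flows of commuting vector fields. -/

section CommutingFrames

open Metric Set

variable {E₁ E : Type*} [NormedAddCommGroup E₁] [NormedSpace ℝ E₁]
  [NormedAddCommGroup E] [NormedSpace ℝ E]

/-! Write `i` for the inclusion of the constraint submanifold. Since `θ⁺ - θ⁻ = σ` and `σ` is
closed, `ω⁺ = ω⁻`. The Lagrange-d'Alembert principle says that `β = i^*θ⁺ - (i ∘ F)^*θ⁻` vanishes on
the inverse image of `Δ` under `T(∂⁺ ∘ i)`. This inverse image is involutive because `Δ` is, so `dβ`
vanishes on pairs of its vectors (`fderiv_symm_of_vanishing`). This is the statement that `F`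
carries `ω⁺` to `ω⁻` there, and with `ω⁺ = ω⁻` it is the symplecticity on `K⁰`
(`IsEvolutionMap.omegaMinus_eq_omegaPlus`).

The other claims rest on one fact: for `w` tangent to the constraint submanifold, `T∂⁻(w) ∈ Δ`
implies `T∂⁺(w) ∈ Δ` (`mfderiv_mem_of_reachable`, `IsHolonomic.tPlus_mem`). Given it, `K⁰` contains
the vectors `w` of the submanifold with `T∂⁻(w) ∈ Δ`, and a dimension count shows that these exhaust
`K⁰` (`comap_inf_comap_le_range`). Invariance follows from `∂⁻ ∘ F = ∂⁺`: the vector `TF(w)` has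
`T∂⁻`-image `T∂⁺(w) ∈ Δ`, and the fact applies again.

To prove the fact, choose a curve `α` with velocity `w` such that `∂⁻ ∘ α` is tangent to `Δ`. It
stays in one leaf, and by reachability `∂⁺ ∘ α` lies in the same leaf. A leaf is only immersed, so
tangency of a curve contained in it is not automatic. By second countability, however, the leaf
meets each foliated chart in countably many local leaves; a continuous curve cannot jump between
countably many labels, so it locally stays in one of them and is tangent to `Δ`
(`tangent_of_forall_mem_leaf`).

The foliated charts come from a weak form of the Frobenius theorem. A normalized frame of an
involutive distribution commutes (`exists_isAdaptedFrame`), and flowing back along it to a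
transversal slice labels the local leaves. The label need not be shown to be smooth: continuity,
zero derivative along tangent curves and the converse suffice. -/

/-- A bounded, globally Lipschitz field `N` of linear maps `E₁ → E` such that, near `y₀`, the vector
fields `N(·)a` commute and are mapped by `ℓ` to the constant fields `a`. -/
structure CommutingFrame (N : E → E₁ →L[ℝ] E) (ℓ : E →L[ℝ] E₁) (y₀ : E) (ρ M C : ℝ)
    (K : NNReal) : Prop where
  pos : 0 < ρ
  nonneg : 0 ≤ C
  norm_le : ∀ y, ‖N y‖ ≤ M
  lipschitz : LipschitzWith K N
  differentiable : Differentiable ℝ N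
  taylor : ∀ y k, ‖N (y + k) - N y - fderiv ℝ N y k‖ ≤ C * ‖k‖ ^ 2
  left_inv : ∀ y ∈ ball y₀ ρ, ∀ a, ℓ (N y a) = a
  comm : ∀ y ∈ ball y₀ ρ, ∀ a b, fderiv ℝ N y (N y a) b = fderiv ℝ N y (N y b) a

namespace CommutingFrame

variable {N : E → E₁ →L[ℝ] E} {ℓ : E →L[ℝ] E₁} {y₀ : E} {ρ M C : ℝ} {K : NNReal}

theorem bound_nonneg (hN : CommutingFrame N ℓ y₀ ρ M C K) : 0 ≤ M :=
  (norm_nonneg _).trans (hN.norm_le y₀)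

theorem lipschitz_apply (hN : CommutingFrame N ℓ y₀ ρ M C K) (v : E₁) :
    LipschitzWith (K * ‖v‖₊) (fun y ↦ N y v) := by
  refine LipschitzWith.of_dist_le_mul fun x y ↦ ?_
  rw [dist_eq_norm, ← sub_apply]
  refine ((N x - N y).le_opNorm v).trans ?_
  have := hN.lipschitz.dist_le_mul x y
  rw [dist_eq_norm] at this
  push_cast
  nlinarith [norm_nonneg v]

/-- The global bound and Lipschitz constant make Picard-Lindelöf work on a fixed time interval, for
every `v` and `z`. -/
theorem exists_flow [CompleteSpace E] (hN : CommutingFrame N ℓ y₀ ρ M C K) (v : E₁) (z : E) :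
    ∃ ψ : ℝ → E, ψ 0 = z ∧ ∀ t ∈ Icc (0 : ℝ) 1, HasDerivAt ψ (N (ψ t) v) t := by
  have hM := hN.bound_nonneg
  -- The interval `[-1, 2]` contains `[0, 1]` in its interior, which gives two-sided derivatives at
  -- `0` and `1`. The radius `2 * (M * ‖v‖)` is the farthest that speed `M * ‖v‖` leads in time `2`.
  have h : IsPicardLindelof (fun _ y ↦ N y v) (tmin := -1) (tmax := 2) ⟨0, by norm_num⟩ z
      (2 * ⟨M * ‖v‖, by positivity⟩) 0 ⟨M * ‖v‖, by positivity⟩ (K * ‖v‖₊) := by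
    refine IsPicardLindelof.of_time_independent (fun x _ ↦ ?_)
      (hN.lipschitz_apply v).lipschitzOnWith ?_
    · exact ((N x).le_opNorm v).trans (by
        change _ ≤ M * ‖v‖
        gcongr
        exact hN.norm_le x)
    · have : max ((2 : ℝ) - 0) (0 - -1) = 2 := by norm_num
      simp only [this]
      change M * ‖v‖ * 2 ≤ 2 * (M * ‖v‖) - 0
      linarith
  obtain ⟨ψ, h0, h1⟩ := h.exists_eq_forall_mem_Icc_hasDerivWithinAt₀
  refine ⟨ψ, h0, fun t ht ↦ (h1 t ⟨by linarith [ht.1], by linarith [ht.2]⟩).hasDerivAt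
    (Icc_mem_nhds (by linarith [ht.1]) (by linarith [ht.2]))⟩

variable [CompleteSpace E]

/-- The integral curve of `N(·)v` that starts at `z`. -/
def flow (hN : CommutingFrame N ℓ y₀ ρ M C K) (v : E₁) (z : E) : ℝ → E :=
  (hN.exists_flow v z).choose

/-- The time one map of the flow of `N(·)v`. -/
def exp (hN : CommutingFrame N ℓ y₀ ρ M C K) (v : E₁) (z : E) : E := hN.flow v z 1

variable (hN : CommutingFrame N ℓ y₀ ρ M C K)
include hN

theorem flow_zero (v : E₁) (z : E) : hN.flow v z 0 = z := (hN.exists_flow v z).choose_spec.1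

theorem hasDerivAt_flow (v : E₁) (z : E) {t : ℝ} (ht : t ∈ Icc (0 : ℝ) 1) :
    HasDerivAt (hN.flow v z) (N (hN.flow v z t) v) t :=
  (hN.exists_flow v z).choose_spec.2 t ht

theorem continuousOn_flow (v : E₁) (z : E) : ContinuousOn (hN.flow v z) (Icc 0 1) :=
  fun _ ht ↦ (hN.hasDerivAt_flow v z ht).continuousAt.continuousWithinAt

theorem norm_flow_sub_le (v : E₁) (z : E) {t : ℝ} (ht : t ∈ Icc (0 : ℝ) 1) :
    ‖hN.flow v z t - z‖ ≤ M * ‖v‖ := by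
  have h := norm_image_sub_le_of_norm_deriv_le_segment' (f := hN.flow v z) (a := 0) (b := 1)
    (C := M * ‖v‖) (fun x hx ↦ (hN.hasDerivAt_flow v z hx).hasDerivWithinAt)
    (fun x _ ↦ ((N _).le_opNorm v).trans (by gcongr; exact hN.norm_le _)) t ht
  rw [hN.flow_zero] at h
  have : 0 ≤ M * ‖v‖ := mul_nonneg hN.bound_nonneg (norm_nonneg _)
  nlinarith [ht.1, ht.2]

theorem norm_exp_sub_le (v : E₁) (z : E) : ‖hN.exp v z - z‖ ≤ M * ‖v‖ :=
  hN.norm_flow_sub_le v z (by simp)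

theorem dist_exp_le (v : E₁) (z z' : E) :
    dist (hN.exp v z) (hN.exp v z') ≤ dist z z' * Real.exp (K * ‖v‖) := by
  have h := dist_le_of_trajectories_ODE (v := fun _ y ↦ N y v) (K := K * ‖v‖₊)
    (f := hN.flow v z) (g := hN.flow v z') (a := 0) (b := 1) (δ := dist z z')
    (fun _ ↦ hN.lipschitz_apply v) (hN.continuousOn_flow v z)
    (fun t ht ↦ (hN.hasDerivAt_flow v z (Ico_subset_Icc_self ht)).hasDerivWithinAt)
    (hN.continuousOn_flow v z')
    (fun t ht ↦ (hN.hasDerivAt_flow v z' (Ico_subset_Icc_self ht)).hasDerivWithinAt)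
    (by rw [hN.flow_zero, hN.flow_zero]) 1 (by simp)
  simpa [exp] using h

/-- The time reversal of an integral curve of `N(·)v` is an integral curve of `N(·)(-v)`; integral
curves are unique. -/
theorem exp_neg_exp (v : E₁) (z : E) : hN.exp (-v) (hN.exp v z) = z := by
  have hm : ∀ t ∈ Icc (0 : ℝ) 1, 1 - t ∈ Icc (0 : ℝ) 1 := fun t ht ↦
    ⟨by linarith [ht.2], by linarith [ht.1]⟩
  have hd : ∀ t ∈ Icc (0 : ℝ) 1, HasDerivAt (fun t ↦ hN.flow v z (1 - t))
      (N (hN.flow v z (1 - t)) (-v)) t := fun t ht ↦ by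
    have := (hN.hasDerivAt_flow v z (hm t ht)).scomp t ((hasDerivAt_id t).const_sub 1)
    simp only [neg_smul, one_smul, ← map_neg] at this
    exact this
  have h := ODE_solution_unique (v := fun _ y ↦ N y (-v)) (K := K * ‖-v‖₊)
    (f := hN.flow (-v) (hN.exp v z)) (g := fun t ↦ hN.flow v z (1 - t)) (a := 0) (b := 1)
    (fun _ ↦ hN.lipschitz_apply (-v)) (hN.continuousOn_flow _ _)
    (fun t ht ↦ (hN.hasDerivAt_flow _ _ (Ico_subset_Icc_self ht)).hasDerivWithinAt)
    (fun t ht ↦ (hd t ht).continuousAt.continuousWithinAt)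
    (fun t ht ↦ (hd t (Ico_subset_Icc_self ht)).hasDerivWithinAt)
    (by simp [hN.flow_zero, exp])
  simpa [exp, hN.flow_zero] using h (show (1 : ℝ) ∈ Icc (0 : ℝ) 1 by simp)

theorem exp_exp_neg (v : E₁) (z : E) : hN.exp v (hN.exp (-v) z) = z := by
  simpa using hN.exp_neg_exp (-v) z

theorem flow_mem_ball {v : E₁} {z : E} (hz : z ∈ ball y₀ (ρ / 2)) (hv : M * ‖v‖ < ρ / 2) {t : ℝ}
    (ht : t ∈ Icc (0 : ℝ) 1) : hN.flow v z t ∈ ball y₀ ρ := by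
  have h1 := hN.norm_flow_sub_le v z ht
  rw [← dist_eq_norm] at h1
  rw [mem_ball] at hz ⊢
  linarith [dist_triangle (hN.flow v z t) z y₀]

/-- This is where commutation enters: `exp` parametrizes a leaf, and its velocity in any direction
`h`, not only in the direction of `v`, is `N(·)h`. With `ψ` the integral curve for `v`, the curve
`ψ(t) + t N(ψ(t))h` solves the equation for `v + h` up to an error `O(‖h‖²)`, and Grönwall's
inequality compares it with the true solution. The two smallness hypotheses keep `ψ` in the ball
where the fields commute. -/
theorem hasFDerivAt_exp {v : E₁} {z : E} (hz : z ∈ ball y₀ (ρ / 2)) (hv : M * ‖v‖ < ρ / 2) :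
    HasFDerivAt (fun v ↦ hN.exp v z) (N (hN.exp v z)) v := by
  have hM := hN.bound_nonneg
  have hC := hN.nonneg
  set ψ := hN.flow v z with hψ
  -- The first summand bounds the term quadratic in `h` that the commutation leaves over, the second
  -- the Taylor remainder.
  set C' : ℝ := K * M + C * M ^ 2 * (‖v‖ + 1) with hC'
  -- A Lipschitz constant of `N(·)(v + h)` for `‖h‖ ≤ 1`; the extra `1` makes it nonzero, for the
  -- closed form of the Grönwall bound.
  set L : NNReal := K * (‖v‖₊ + 1) + 1 with hL
  have hL0 : (L : ℝ) ≠ 0 := by rw [hL]; push_cast; positivity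
  have key : ∀ h : E₁, ‖h‖ ≤ 1 → ‖hN.exp (v + h) z - hN.exp v z - N (hN.exp v z) h‖ ≤
      (C' / L * (Real.exp L - 1)) * ‖h‖ ^ 2 := by
    intro h hh
    set χ : ℝ → E := fun t ↦ ψ t + t • N (ψ t) h with hχ
    set χ' : ℝ → E := fun t ↦
      N (ψ t) v + (t • fderiv ℝ N (ψ t) (N (ψ t) v) h + N (ψ t) h) with hχ'
    have hd : ∀ t ∈ Icc (0 : ℝ) 1, HasDerivAt χ (χ' t) t := by
      intro t ht
      have h1 := hN.hasDerivAt_flow v z ht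
      have h2 := ((hN.differentiable (ψ t)).hasFDerivAt.comp_hasDerivAt t h1).clm_apply
        (hasDerivAt_const t h)
      have h3 := h1.add ((hasDerivAt_id t).smul h2)
      simp only [map_zero, add_zero, one_smul, id] at h3
      exact h3
    have hb : ∀ t ∈ Ico (0 : ℝ) 1, dist (χ' t) (N (χ t) (v + h)) ≤ C' * ‖h‖ ^ 2 := by
      intro t ht
      have ht' := Ico_subset_Icc_self ht
      have hc := hN.comm (ψ t) (hN.flow_mem_ball hz hv ht') v h
      have hNh : ‖N (ψ t) h‖ ≤ M * ‖h‖ := ((N _).le_opNorm h).trans (by gcongr; exact hN.norm_le _)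
      have htN : ‖t • N (ψ t) h‖ ≤ M * ‖h‖ := by
        rw [norm_smul, Real.norm_of_nonneg ht.1]
        nlinarith [ht.2, norm_nonneg (N (ψ t) h)]
      have hT := hN.taylor (ψ t) (t • N (ψ t) h)
      have hD : ‖fderiv ℝ N (ψ t)‖ ≤ K := norm_fderiv_le_of_lipschitz ℝ hN.lipschitz
      -- By `hc`, the term `t DN(N v)h` from differentiating `χ` cancels `t DN(N h)v` from expanding
      -- `N (χ t) v`: nothing linear in `h` remains.
      have e : χ' t - N (χ t) (v + h) =
          -(fderiv ℝ N (ψ t) (t • N (ψ t) h) h) -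
          (N (ψ t + t • N (ψ t) h) - N (ψ t) - fderiv ℝ N (ψ t) (t • N (ψ t) h)) (v + h) := by
        simp only [hχ', hχ, map_add, map_smul, sub_apply, smul_apply, hc]
        abel
      rw [dist_eq_norm, e]
      have h1 : ‖fderiv ℝ N (ψ t) (t • N (ψ t) h) h‖ ≤ K * M * ‖h‖ ^ 2 := by
        calc _ ≤ ‖fderiv ℝ N (ψ t)‖ * ‖t • N (ψ t) h‖ * ‖h‖ :=
              (fderiv ℝ N (ψ t)).le_opNorm₂ _ _
          _ ≤ K * (M * ‖h‖) * ‖h‖ := by gcongr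
          _ = _ := by ring
      have h2 : ‖(N (ψ t + t • N (ψ t) h) - N (ψ t) - fderiv ℝ N (ψ t) (t • N (ψ t) h)) (v + h)‖
          ≤ C * M ^ 2 * (‖v‖ + 1) * ‖h‖ ^ 2 := by
        calc _ ≤ (C * ‖t • N (ψ t) h‖ ^ 2) * ‖v + h‖ :=
              (ContinuousLinearMap.le_opNorm _ _).trans (by gcongr)
          _ ≤ (C * (M * ‖h‖) ^ 2) * (‖v‖ + 1) := by
              gcongr
              exact (norm_add_le _ _).trans (by gcongr)
          _ = _ := by ring
      refine (norm_sub_le _ _).trans ?_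
      rw [norm_neg, hC']
      linarith
    have hLip : LipschitzWith L (fun y ↦ N y (v + h)) := by
      refine (hN.lipschitz_apply (v + h)).weaken ?_
      rw [← NNReal.coe_le_coe, hL]
      push_cast
      have : ‖v + h‖ ≤ ‖v‖ + 1 := (norm_add_le _ _).trans (by gcongr)
      nlinarith [K.coe_nonneg]
    have hG := dist_le_of_approx_trajectories_ODE (v := fun _ y ↦ N y (v + h)) (K := L)
      (f := χ) (f' := χ') (g := hN.flow (v + h) z)
      (g' := fun t ↦ N (hN.flow (v + h) z t) (v + h)) (a := 0) (b := 1) (δ := 0)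
      (εf := C' * ‖h‖ ^ 2) (εg := 0) (fun _ ↦ hLip)
      (fun t ht ↦ (hd t ht).continuousAt.continuousWithinAt)
      (fun t ht ↦ (hd t (Ico_subset_Icc_self ht)).hasDerivWithinAt) hb
      (hN.continuousOn_flow _ _)
      (fun t ht ↦ (hN.hasDerivAt_flow _ _ (Ico_subset_Icc_self ht)).hasDerivWithinAt)
      (by simp) (by simp [hχ, hψ, hN.flow_zero]) 1 (by simp)
    rw [gronwallBound_of_K_ne_0 hL0, dist_eq_norm, ← norm_neg] at hG
    have e1 : -(χ 1 - hN.flow (v + h) z 1) =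
        hN.exp (v + h) z - hN.exp v z - N (hN.exp v z) h := by
      simp only [hχ, exp, one_smul, hψ]
      abel
    rw [e1] at hG
    refine hG.trans (le_of_eq ?_)
    simp
    ring
  rw [hasFDerivAt_iff_isLittleO_nhds_zero]
  have hO : (fun h ↦ hN.exp (v + h) z - hN.exp v z - N (hN.exp v z) h) =O[𝓝 0]
      fun h : E₁ ↦ ‖h‖ ^ 2 := by
    refine Asymptotics.IsBigO.of_bound (C' / L * (Real.exp L - 1)) ?_
    filter_upwards [closedBall_mem_nhds (0 : E₁) one_pos] with h hh
    rw [Real.norm_of_nonneg (by positivity)]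
    exact key h (by simpa using hh)
  refine hO.trans_isLittleO ?_
  simpa using Asymptotics.isLittleO_norm_pow_id (E' := E₁) one_lt_two

end CommutingFrame

end CommutingFrames

/-! ### Local leaves of a commuting frame and their labels. -/

section Labels

open Metric Set

variable {E₁ E : Type*} [NormedAddCommGroup E₁] [NormedSpace ℝ E₁]
  [NormedAddCommGroup E] [NormedSpace ℝ E]

namespace CommutingFrame

variable {N : E → E₁ →L[ℝ] E} {ℓ : E →L[ℝ] E₁} {y₀ : E} {ρ M C : ℝ} {K : NNReal}

/-- The neighbourhood of `y₀` on which `label` distinguishes the leaves. -/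
def core (_hN : CommutingFrame N ℓ y₀ ρ M C K) : Set E := ball y₀ (ρ / 4) ∩ {y | M * ‖ℓ (y - y₀)‖ < ρ / 4}

variable (hN : CommutingFrame N ℓ y₀ ρ M C K)
include hN

theorem isOpen_core : IsOpen hN.core :=
  isOpen_ball.inter (isOpen_lt (by fun_prop) continuous_const)

theorem mem_core : y₀ ∈ hN.core :=
  ⟨mem_ball_self (by linarith [hN.pos]), by
    simpa using hN.pos⟩

theorem core_subset : hN.core ⊆ ball y₀ ρ := fun _ hy ↦
  ball_subset_ball (by linarith [hN.pos]) hy.1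

theorem bound_proj_lt {y : E} (hy : y ∈ hN.core) : M * ‖ℓ (y - y₀)‖ < ρ / 2 := by
  have h2 : M * ‖ℓ (y - y₀)‖ < ρ / 4 := hy.2
  linarith [hN.pos]

variable [CompleteSpace E]

/-- The point where the leaf through `y` meets the slice `ℓ = ℓ y₀`. -/
def label (y : E) : E := hN.exp (-(ℓ (y - y₀))) y

/-- The two bounds `ρ / 4` in `core` add up to `ρ / 2`, the radius that `hasFDerivAt_exp` allows for
a starting point. -/
theorem label_mem_ball {y : E} (hy : y ∈ hN.core) : hN.label y ∈ ball y₀ (ρ / 2) := by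
  have h := hN.norm_exp_sub_le (-(ℓ (y - y₀))) y
  have h1 := hy.1
  have h2 : M * ‖ℓ (y - y₀)‖ < ρ / 4 := hy.2
  rw [norm_neg, ← dist_eq_norm] at h
  rw [mem_ball] at h1 ⊢
  linarith [dist_triangle (hN.label y) y y₀, show dist (hN.label y) y ≤ _ from h]

theorem exp_label (y : E) : hN.exp (ℓ (y - y₀)) (hN.label y) = y := hN.exp_exp_neg _ _

/-- Flowing back by `-ℓ (y' - y₀)` takes `y'` to its label and the comparison point on the leaf of
`y` to the label of `y`; the flow is Lipschitz in its starting point. All regularity of `label` is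
drawn from this estimate. -/
theorem dist_label_le (y : E) {y' : E} (hy' : y' ∈ hN.core) :
    dist (hN.label y') (hN.label y) ≤
      dist y' (hN.exp (ℓ (y' - y₀)) (hN.label y)) * Real.exp (K * (‖ℓ‖ * ρ)) := by
  have h := hN.dist_exp_le (-(ℓ (y' - y₀))) y' (hN.exp (ℓ (y' - y₀)) (hN.label y))
  rw [exp_neg_exp, norm_neg] at h
  refine h.trans ?_
  gcongr
  refine (ℓ.le_opNorm _).trans ?_
  gcongr
  have := hN.core_subset hy'
  rw [mem_ball, dist_eq_norm] at this
  exact this.le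

/-- The map moves `y'` onto the leaf of `y`, keeping `ℓ` as the parameter; to first order it is the
projection `N y ∘ ℓ` onto the tangent space of the leaf. -/
theorem hasFDerivAt_exp_label {y : E} (hy : y ∈ hN.core) :
    HasFDerivAt (fun y' ↦ hN.exp (ℓ (y' - y₀)) (hN.label y)) (N y ∘L ℓ) y := by
  have h := hN.hasFDerivAt_exp (hN.label_mem_ball hy) (hN.bound_proj_lt hy)
  rw [hN.exp_label] at h
  exact h.comp (f := fun y' ↦ ℓ (y' - y₀)) y
    (ℓ.hasFDerivAt.comp y ((hasFDerivAt_id y).sub_const y₀))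

theorem continuousAt_label {y : E} (hy : y ∈ hN.core) : ContinuousAt hN.label y := by
  have h : Filter.Tendsto (fun y' ↦ dist y' (hN.exp (ℓ (y' - y₀)) (hN.label y)) *
      Real.exp (K * (‖ℓ‖ * ρ))) (𝓝 y) (𝓝 0) := by
    have : Filter.Tendsto _ _ _ := (continuousAt_id.dist
      (hN.hasFDerivAt_exp_label hy).continuousAt).mul_const (Real.exp (K * (‖ℓ‖ * ρ)))
    simpa only [id, hN.exp_label, dist_self, zero_mul] using this
  rw [ContinuousAt, tendsto_iff_dist_tendsto_zero]
  refine squeeze_zero' (Filter.Eventually.of_forall fun _ ↦ dist_nonneg) ?_ h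
  filter_upwards [hN.isOpen_core.mem_nhds hy] with y' hy'
  exact hN.dist_label_le y hy'

/-- By `dist_label_le`, the label varies at most as fast as the distance from `c` to its projection
on the leaf, and for a tangent velocity this distance is of order `o(t' - t)`. -/
theorem hasDerivWithinAt_label {c : ℝ → E} {c' : E} {s : Set ℝ} {t : ℝ} (hc : c t ∈ hN.core)
    (hd : HasDerivWithinAt c c' s t) (hc' : N (c t) (ℓ c') = c') :
    HasDerivWithinAt (fun t ↦ hN.label (c t)) 0 s t := by
  have h1 := hd.sub ((hN.hasFDerivAt_exp_label hc).comp_hasDerivWithinAt t hd)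
  rw [ContinuousLinearMap.comp_apply, hc', sub_self] at h1
  rw [hasDerivWithinAt_iff_isLittleO] at h1 ⊢
  refine Asymptotics.IsBigO.trans_isLittleO ?_ h1
  refine Asymptotics.IsBigO.of_bound (Real.exp (K * (‖ℓ‖ * ρ))) ?_
  filter_upwards [hd.continuousWithinAt (hN.isOpen_core.mem_nhds hc)] with t' ht'
  have := hN.dist_label_le (c t) ht'
  rw [dist_eq_norm, dist_eq_norm] at this
  simpa only [Pi.sub_apply, Function.comp_apply, hN.exp_label, sub_self, sub_zero, smul_zero,
    mul_comm] using this

/-- If the label is constant, `c` equals its own projection on the leaf; differentiate both curves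
and compare. -/
theorem tangent_of_label_eq {c : ℝ → E} {c' : E} {t : ℝ} (hc : c t ∈ hN.core)
    (hd : HasDerivAt c c' t) (hl : ∀ᶠ t' in 𝓝 t, hN.label (c t') = hN.label (c t)) :
    N (c t) (ℓ c') = c' := by
  refine HasDerivAt.unique ((hN.hasFDerivAt_exp_label hc).comp_hasDerivAt t hd)
    (hd.congr_of_eventuallyEq ?_)
  filter_upwards [hl] with t' ht'
  rw [Function.comp_apply, ← ht', hN.exp_label]

/-- Points with the label of `y` are values of `exp` at that label, so the segment from `ℓ (y - y₀)`
to `ℓ (y' - y₀)` in parameter space maps to a tangent curve. -/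
theorem exists_tangent_curve {y : E} (hy : y ∈ hN.core) {O : Set E} (hO : O ∈ 𝓝 y) :
    ∃ u ∈ 𝓝 y, ∀ y' ∈ u, hN.label y' = hN.label y → ∃ (c : ℝ → E) (w : E₁), c 0 = y ∧ c 1 = y' ∧
      ∀ t ∈ Icc (0 : ℝ) 1, c t ∈ O ∧ HasDerivAt c (N (c t) w) t := by
  have h := hN.hasFDerivAt_exp (hN.label_mem_ball hy) (hN.bound_proj_lt hy)
  have h1 : ∀ᶠ v in 𝓝 (ℓ (y - y₀)), hN.exp v (hN.label y) ∈ O := by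
    refine h.continuousAt.eventually (p := (· ∈ O)) ?_
    simp only [hN.exp_label]
    exact hO
  have h2 : ∀ᶠ v in 𝓝 (ℓ (y - y₀)), M * ‖v‖ < ρ / 2 :=
    (show Continuous fun v : E₁ ↦ M * ‖v‖ by fun_prop).continuousAt.eventually_lt
      continuousAt_const (hN.bound_proj_lt hy)
  obtain ⟨δ, hδ, hball⟩ := Metric.eventually_nhds_iff_ball.1 (h1.and h2)
  refine ⟨(fun y' ↦ ℓ (y' - y₀)) ⁻¹' ball (ℓ (y - y₀)) δ,
    (show Continuous fun y' ↦ ℓ (y' - y₀) by fun_prop).continuousAt.preimage_mem_nhds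
      (ball_mem_nhds _ hδ), fun y' hy' hl ↦ ?_⟩
  refine ⟨fun t ↦ hN.exp (ℓ (y - y₀) + t • (ℓ (y' - y₀) - ℓ (y - y₀))) (hN.label y),
    ℓ (y' - y₀) - ℓ (y - y₀), by simp only [zero_smul, add_zero, hN.exp_label], ?_, fun t ht ↦ ?_⟩
  · simp only [one_smul, add_sub_cancel]
    rw [← hl, hN.exp_label]
  · have hm := hball _ ((convex_ball (ℓ (y - y₀)) δ).add_smul_sub_mem (mem_ball_self hδ) hy' ht)
    refine ⟨hm.1, ?_⟩
    have hl := ((hasDerivAt_id t).smul_const (ℓ (y' - y₀) - ℓ (y - y₀))).const_add (ℓ (y - y₀))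
    have := (hN.hasFDerivAt_exp (hN.label_mem_ball hy) hm.2).comp_hasDerivAt t hl
    simp only [one_smul] at this
    exact this

end CommutingFrame

end Labels

/-! ### Globalizing a local frame and normalizing it. -/

section NormalForms

open Metric Set

variable {E₁ E : Type*} [NormedAddCommGroup E₁] [NormedSpace ℝ E₁]
  [NormedAddCommGroup E] [NormedSpace ℝ E]

/-- A family of linear maps with local commuting property agrees near `y₀` with a commuting frame. -/
theorem exists_commutingFrame [FiniteDimensional ℝ E] {N₀ : E → E₁ →L[ℝ] E} {ℓ : E →L[ℝ] E₁}
    {y₀ : E} {s : Set E} (hy₀ : s ∈ 𝓝 y₀) (hs : ContDiffAt ℝ 2 N₀ y₀)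
    (hl : ∀ᶠ y in 𝓝 y₀, ∀ a, ℓ (N₀ y a) = a)
    (hc : ∀ᶠ y in 𝓝 y₀, ∀ a b, fderiv ℝ N₀ y (N₀ y a) b = fderiv ℝ N₀ y (N₀ y b) a) :
    ∃ (N : E → E₁ →L[ℝ] E) (ρ M C : ℝ) (K : NNReal), CommutingFrame N ℓ y₀ ρ M C K ∧
      ball y₀ ρ ⊆ s ∧ ∀ y ∈ ball y₀ ρ, N y = N₀ y := by
  have hev : ∀ᶠ y in 𝓝 y₀, ContDiffAt ℝ 2 N₀ y ∧ (∀ a, ℓ (N₀ y a) = a) ∧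
      (∀ a b, fderiv ℝ N₀ y (N₀ y a) b = fderiv ℝ N₀ y (N₀ y b) a) ∧ y ∈ s :=
    (hs.eventually (by simp)).and (hl.and (hc.and hy₀))
  obtain ⟨R, hR, hball⟩ := Metric.eventually_nhds_iff_ball.1 hev
  -- The inner radius `R / 3` becomes `ρ`, where the cut-off is `1`; the outer radius keeps the
  -- support inside the ball of good points. Compact support then supplies the global constants.
  let χ : ContDiffBump y₀ := ⟨R / 3, R / 2, by positivity, by linarith⟩
  let N : E → E₁ →L[ℝ] E := fun y ↦ χ y • N₀ y
  have hχ : tsupport χ ⊆ ball y₀ R := by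
    rw [χ.tsupport_eq]
    exact closedBall_subset_ball (by change R / 2 < R; linarith)
  have hsupp : tsupport N ⊆ tsupport χ := tsupport_smul_subset_left _ _
  have hN2 : ContDiff ℝ 2 N := by
    rw [contDiff_iff_contDiffAt]
    intro y
    by_cases hy : y ∈ tsupport N
    · exact χ.contDiffAt.smul (hball y (hχ (hsupp hy))).1
    · exact contDiffAt_const.congr_of_eventuallyEq (notMem_tsupport_iff_eventuallyEq.1 hy)
  have hcs : HasCompactSupport N := χ.hasCompactSupport.mono' (subset_tsupport _ |>.trans hsupp)
  have hN' : ContDiff ℝ 1 (fderiv ℝ N) := hN2.fderiv_right (by norm_num)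
  have hcs' : HasCompactSupport (fderiv ℝ N) := hcs.fderiv ℝ
  obtain ⟨K, hK⟩ := ContDiff.lipschitzWith_of_hasCompactSupport hcs hN2 two_ne_zero
  obtain ⟨C, hC⟩ : ∃ C : NNReal, LipschitzWith C (fderiv ℝ N) :=
    ContDiff.lipschitzWith_of_hasCompactSupport hcs' hN' one_ne_zero
  obtain ⟨M, hM⟩ := hcs.exists_bound_of_continuous hN2.continuous
  have hdiff : Differentiable ℝ N := hN2.differentiable (by simp)
  have heq : ∀ y ∈ ball y₀ (R / 3), N =ᶠ[𝓝 y] N₀ := fun y hy ↦ by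
    filter_upwards [χ.eventuallyEq_one_of_mem_ball hy] with x hx
    simp only [N, hx, Pi.one_apply, one_smul]
  have hsub : ball y₀ (R / 3) ⊆ ball y₀ R := ball_subset_ball (by linarith)
  refine ⟨N, R / 3, M, C, K, ⟨by positivity, C.coe_nonneg, hM, hK, hdiff, fun y k ↦ ?_,
    fun y hy a ↦ ?_, fun y hy a b ↦ ?_⟩,
    fun y hy ↦ (hball y (hsub hy)).2.2.2, fun y hy ↦ (heq y hy).eq_of_nhds⟩
  -- The Taylor bound is the mean value inequality on the ball of radius `‖k‖`, where the derivative
  -- differs from its value at the centre by at most `C * ‖k‖`.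
  · have h := (convex_closedBall y ‖k‖).norm_image_sub_le_of_norm_hasFDerivWithin_le'
      (f := N) (φ := fderiv ℝ N y) (C := C * ‖k‖) (x := y) (y := y + k)
      (fun x _ ↦ (hdiff x).hasFDerivAt.hasFDerivWithinAt) (fun x hx ↦ by
        rw [← dist_eq_norm]
        exact (hC.dist_le_mul x y).trans (by gcongr; exact hx)) (by simp) (by simp)
    rw [add_sub_cancel_left] at h
    rwa [sq, ← mul_assoc]
  · rw [(heq y hy).eq_of_nhds]
    exact (hball y (hsub hy)).2.1 a
  · rw [(heq y hy).eq_of_nhds, (heq y hy).fderiv_eq]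
    exact (hball y (hsub hy)).2.2.1 a b

/-- Near `y₀`, the span of independent vector fields is the range of a family of linear maps with a
constant left inverse. -/
theorem exists_normalized_frame [FiniteDimensional ℝ E] {k : ℕ} {X : Fin k → E → E} {u : Set E}
    {y₀ : E} (hu : IsOpen u) (hy₀ : y₀ ∈ u) (hX : ∀ i, ContDiffOn ℝ ∞ (X i) u)
    (hli : LinearIndependent ℝ fun i ↦ X i y₀) :
    ∃ (N : E → (Fin k → ℝ) →L[ℝ] E) (ℓ : E →L[ℝ] Fin k → ℝ) (u' : Set E), IsOpen u' ∧ y₀ ∈ u' ∧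
      u' ⊆ u ∧ ContDiffOn ℝ ∞ N u' ∧ (∀ y ∈ u', ∀ a, ℓ (N y a) = a) ∧
      ∀ y ∈ u', (N y).range = Submodule.span ℝ (range fun i ↦ X i y) := by
  let Mat : E → (Fin k → ℝ) →L[ℝ] E := fun y ↦
    ∑ i, (ContinuousLinearMap.proj (R := ℝ) (φ := fun _ : Fin k ↦ ℝ) i).smulRight (X i y)
  have hMat : ∀ y, (Mat y).toLinearMap = Fintype.linearCombination ℝ fun i ↦ X i y := fun y ↦ by
    ext i
    simp [Mat, Fintype.linearCombination_apply]
  have hMs : ContDiffOn ℝ ∞ Mat u := ContDiffOn.sum fun i _ ↦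
    (ContinuousLinearMap.smulRightL ℝ (Fin k → ℝ) E
      (ContinuousLinearMap.proj (R := ℝ) (φ := fun _ : Fin k ↦ ℝ) i)).contDiff.comp_contDiffOn (hX i)
  obtain ⟨g, hg⟩ := (Mat y₀).toLinearMap.exists_leftInverse_of_injective (by
    rw [hMat, LinearMap.ker_eq_bot]
    exact hli.fintypeLinearCombination_injective)
  let ℓ : E →L[ℝ] Fin k → ℝ := LinearMap.toContinuousLinearMap g
  let T : E → (Fin k → ℝ) →L[ℝ] (Fin k → ℝ) := fun y ↦ ℓ ∘L Mat y
  have hT₀ : T y₀ = 1 := by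
    ext1 a
    exact LinearMap.congr_fun hg a
  have hTs : ContDiffOn ℝ ∞ T u := contDiffOn_const.clm_comp hMs
  let u' := u ∩ T ⁻¹' {x | IsUnit x}
  have hu' : IsOpen u' := hTs.continuousOn.isOpen_inter_preimage hu Units.isOpen
  have hinv : ContDiffOn ℝ ∞ (fun y ↦ Ring.inverse (T y)) u' := fun y hy ↦ by
    obtain ⟨x, hx⟩ := hy.2
    have h := contDiffAt_ringInverse ℝ (n := ∞) x
    rw [hx] at h
    exact h.comp_contDiffWithinAt y ((hTs y hy.1).mono inter_subset_left)
  -- Since `ℓ ∘ Mat y = T y`, composing `Mat y` with the inverse of `T y` makes `ℓ` a left inverse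
  -- for all `y` near `y₀`, without changing the range.
  refine ⟨fun y ↦ Mat y ∘L Ring.inverse (T y), ℓ, u', hu', ⟨hy₀, by simp [hT₀]⟩, inter_subset_left,
    (hMs.mono inter_subset_left).clm_comp hinv, fun y hy a ↦ ?_, fun y hy ↦ ?_⟩
  · exact DFunLike.congr_fun (Ring.mul_inverse_cancel (T y) hy.2) a
  · rw [← Fintype.range_linearCombination, ← hMat]
    refine LinearMap.range_comp_of_range_eq_top (f := (Ring.inverse (T y)).toLinearMap)
      (Mat y).toLinearMap (LinearMap.range_eq_top.2 fun b ↦ ⟨T y b, ?_⟩)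
    exact DFunLike.congr_fun (Ring.inverse_mul_cancel (T y) hy.2) b

end NormalForms

/-! ### Distributions in charts: involutivity becomes commutation. -/

section Charts

open Set

variable {E : Type*} [NormedAddCommGroup E] [NormedSpace ℝ E]
  {M : Type*} [TopologicalSpace M] [ChartedSpace E M] [IsManifold 𝓘(ℝ, E) ∞ M]

theorem contMDiffAt_chart {m₀ m : M} (hm : m ∈ (extChartAt 𝓘(ℝ, E) m₀).source) :
    ContMDiffAt 𝓘(ℝ, E) 𝓘(ℝ, E) ∞ (extChartAt 𝓘(ℝ, E) m₀) m :=
  contMDiffAt_extChartAt' (by rwa [← extChartAt_source 𝓘(ℝ, E)])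

theorem contMDiffAt_chart_symm {m₀ : M} {y : E} (hy : y ∈ (extChartAt 𝓘(ℝ, E) m₀).target) :
    ContMDiffAt 𝓘(ℝ, E) 𝓘(ℝ, E) ∞ (extChartAt 𝓘(ℝ, E) m₀).symm y :=
  (contMDiffOn_extChartAt_symm m₀).contMDiffAt ((isOpen_extChartAt_target m₀).mem_nhds hy)

theorem mdifferentiableAt_chart {m₀ m : M} (hm : m ∈ (extChartAt 𝓘(ℝ, E) m₀).source) :
    MDifferentiableAt 𝓘(ℝ, E) 𝓘(ℝ, E) (extChartAt 𝓘(ℝ, E) m₀) m :=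
  (contMDiffAt_chart hm).mdifferentiableAt (by simp)

theorem mdifferentiableAt_chart_symm {m₀ : M} {y : E}
    (hy : y ∈ (extChartAt 𝓘(ℝ, E) m₀).target) :
    MDifferentiableAt 𝓘(ℝ, E) 𝓘(ℝ, E) (extChartAt 𝓘(ℝ, E) m₀).symm y :=
  (contMDiffAt_chart_symm hy).mdifferentiableAt (by simp)

theorem isInvertible_mfderiv_chart_symm {m₀ : M} {y : E}
    (hy : y ∈ (extChartAt 𝓘(ℝ, E) m₀).target) :
    (mfderiv 𝓘(ℝ, E) 𝓘(ℝ, E) (extChartAt 𝓘(ℝ, E) m₀).symm y).IsInvertible := by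
  have h := isInvertible_mfderivWithin_extChartAt_symm (I := 𝓘(ℝ, E)) hy
  rwa [show range 𝓘(ℝ, E) = univ by simp, mfderivWithin_univ] at h

theorem mfderiv_chart_symm_apply {m₀ m : M} (hm : m ∈ (extChartAt 𝓘(ℝ, E) m₀).source)
    (a : TangentSpace 𝓘(ℝ, E) m) :
    mfderiv 𝓘(ℝ, E) 𝓘(ℝ, E) (extChartAt 𝓘(ℝ, E) m₀).symm (extChartAt 𝓘(ℝ, E) m₀ m)
      (mfderiv 𝓘(ℝ, E) 𝓘(ℝ, E) (extChartAt 𝓘(ℝ, E) m₀) m a) = a := by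
  have h := mfderivWithin_extChartAt_symm_comp_mfderiv_extChartAt' (I := 𝓘(ℝ, E)) hm
  rw [show range 𝓘(ℝ, E) = univ by simp, mfderivWithin_univ] at h
  exact DFunLike.congr_fun h a

theorem mfderiv_chart_apply {m₀ m : M} (hm : m ∈ (extChartAt 𝓘(ℝ, E) m₀).source) (a : E) :
    mfderiv 𝓘(ℝ, E) 𝓘(ℝ, E) (extChartAt 𝓘(ℝ, E) m₀) m
      (mfderiv 𝓘(ℝ, E) 𝓘(ℝ, E) (extChartAt 𝓘(ℝ, E) m₀).symm (extChartAt 𝓘(ℝ, E) m₀ m) a) = a := by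
  have h := mfderiv_extChartAt_comp_mfderivWithin_extChartAt_symm' (I := 𝓘(ℝ, E)) hm
  rw [show range 𝓘(ℝ, E) = univ by simp, mfderivWithin_univ] at h
  exact DFunLike.congr_fun h a

theorem mfderiv_chart_injective {m₀ m : M} (hm : m ∈ (extChartAt 𝓘(ℝ, E) m₀).source) :
    Function.Injective (mfderiv 𝓘(ℝ, E) 𝓘(ℝ, E) (extChartAt 𝓘(ℝ, E) m₀) m) :=
  Function.LeftInverse.injective (mfderiv_chart_symm_apply hm)

/-- The pull-back of a smooth vector field by the inverse of a chart is smooth. -/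
theorem contDiffOn_chart_field [CompleteSpace E] (m₀ : M) {X : ∀ m : M, TangentSpace 𝓘(ℝ, E) m}
    {u : Set M} (hu : IsOpen u)
    (hX : ContMDiffOn 𝓘(ℝ, E) 𝓘(ℝ, E).tangent ∞
      (fun m ↦ (⟨m, X m⟩ : TangentBundle 𝓘(ℝ, E) M)) u) :
    ContDiffOn ℝ ∞ (VectorField.mpullback 𝓘(ℝ, E) 𝓘(ℝ, E) (extChartAt 𝓘(ℝ, E) m₀).symm X : E → E)
      ((extChartAt 𝓘(ℝ, E) m₀).target ∩ (extChartAt 𝓘(ℝ, E) m₀).symm ⁻¹' u) := by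
  intro y hy
  have h := ContMDiffAt.mpullback_vectorField_preimage (m := ∞) (n := ∞)
    (hX.contMDiffAt (hu.mem_nhds hy.2)) (contMDiffAt_chart_symm hy.1)
    (isInvertible_mfderiv_chart_symm hy.1) (by simp)
  exact (contMDiffAt_vectorSpace_iff_contDiffAt.1 h).contDiffWithinAt

theorem inverse_mfderiv_chart_symm {m₀ m : M} (hm : m ∈ (extChartAt 𝓘(ℝ, E) m₀).source)
    (a : TangentSpace 𝓘(ℝ, E) m) :
    (mfderiv 𝓘(ℝ, E) 𝓘(ℝ, E) (extChartAt 𝓘(ℝ, E) m₀).symm (extChartAt 𝓘(ℝ, E) m₀ m)).inverse a =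
      mfderiv 𝓘(ℝ, E) 𝓘(ℝ, E) (extChartAt 𝓘(ℝ, E) m₀) m a := by
  have hi := isInvertible_mfderiv_chart_symm (E := E) ((extChartAt 𝓘(ℝ, E) m₀).map_source hm)
  exact hi.inverse_apply_eq.2 (mfderiv_chart_symm_apply hm a).symm

theorem isInvertible_mfderiv_chart {m₀ m : M} (hm : m ∈ (extChartAt 𝓘(ℝ, E) m₀).source) :
    (mfderiv 𝓘(ℝ, E) 𝓘(ℝ, E) (extChartAt 𝓘(ℝ, E) m₀) m).IsInvertible :=
  isInvertible_mfderiv_extChartAt hm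

omit [NormedSpace ℝ E] in
theorem mem_span_range_iff_of_injective [Module ℝ E] {ι : Type*} {f : E →ₗ[ℝ] E}
    (hf : Function.Injective f) (v : ι → E) (b : E) :
    b ∈ Submodule.span ℝ (range v) ↔ f b ∈ Submodule.span ℝ (range fun i ↦ f (v i)) := by
  rw [range_comp' f v, Submodule.span_image]
  exact (hf.mem_set_image (s := Submodule.span ℝ (range v))).symm

theorem mlieBracket_eq_lieBracket (V W : ∀ x : E, TangentSpace 𝓘(ℝ, E) x) (x : E) :
    VectorField.mlieBracket 𝓘(ℝ, E) V W x = VectorField.lieBracket ℝ (V : E → E) (W : E → E) x := by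
  rw [← VectorField.mlieBracketWithin_univ, VectorField.mlieBracketWithin_eq_lieBracketWithin]
  exact congrFun (VectorField.lieBracketWithin_univ (V := (V : E → E)) (W := (W : E → E))) x

/-- The frame `N` describes the distribution `Δ` in the chart at `m₀`, on the open set `u`: in the
chart, `Δ` is the range of `N`, and the vector fields `N(·)a` commute. -/
structure IsAdaptedFrame (Δ : ∀ m : M, Submodule ℝ (TangentSpace 𝓘(ℝ, E) m)) (m₀ : M) {k : ℕ}
    (N : E → (Fin k → ℝ) →L[ℝ] E) (ℓ : E →L[ℝ] Fin k → ℝ) (u : Set E) : Prop where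
  isOpen : IsOpen u
  mem : extChartAt 𝓘(ℝ, E) m₀ m₀ ∈ u
  contDiffOn : ContDiffOn ℝ ∞ N u
  left_inv : ∀ y ∈ u, ∀ a, ℓ (N y a) = a
  mem_iff : ∀ m ∈ (extChartAt 𝓘(ℝ, E) m₀).source, extChartAt 𝓘(ℝ, E) m₀ m ∈ u →
    ∀ b : TangentSpace 𝓘(ℝ, E) m, b ∈ Δ m ↔
      N (extChartAt 𝓘(ℝ, E) m₀ m) (ℓ (mfderiv 𝓘(ℝ, E) 𝓘(ℝ, E) (extChartAt 𝓘(ℝ, E) m₀) m b)) =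
        mfderiv 𝓘(ℝ, E) 𝓘(ℝ, E) (extChartAt 𝓘(ℝ, E) m₀) m b
  comm : ∀ y ∈ u, ∀ a b, fderiv ℝ N y (N y a) b = fderiv ℝ N y (N y b) a

/-- For a normalized frame, involutivity forces the brackets to vanish: they lie in the range of
`N`, on which `ℓ` is injective, and `ℓ` kills them because `ℓ (N y a) = a` does not depend on `y`.
-/
theorem exists_isAdaptedFrame [FiniteDimensional ℝ E]
    {Δ : ∀ m : M, Submodule ℝ (TangentSpace 𝓘(ℝ, E) m)} (hΔ : IsDistribution Δ)
    (hI : IsInvolutive Δ) (m₀ : M) :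
    ∃ (k : ℕ) (N : E → (Fin k → ℝ) →L[ℝ] E) (ℓ : E →L[ℝ] Fin k → ℝ) (u : Set E),
      IsAdaptedFrame Δ m₀ N ℓ u := by
  have : CompleteSpace E := FiniteDimensional.complete ℝ E
  obtain ⟨k, w, X, hw, hm₀, hX, hspan⟩ := hΔ m₀
  set φ := extChartAt 𝓘(ℝ, E) m₀ with hφ
  let X' : Fin k → E → E := fun i ↦ VectorField.mpullback 𝓘(ℝ, E) 𝓘(ℝ, E) φ.symm (X i)
  have hX' : ∀ i, ∀ m ∈ φ.source, X' i (φ m) = mfderiv 𝓘(ℝ, E) 𝓘(ℝ, E) φ m (X i m) := by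
    intro i m hm
    have h := inverse_mfderiv_chart_symm hm (X i m)
    simp only [X', VectorField.mpullback_apply]
    rw [φ.left_inv hm]
    exact h
  have hopen : IsOpen (φ.target ∩ φ.symm ⁻¹' w) :=
    (contMDiffOn_extChartAt_symm (n := ∞) m₀).continuousOn.isOpen_inter_preimage
      (isOpen_extChartAt_target m₀) hw
  have hmem : φ m₀ ∈ φ.target ∩ φ.symm ⁻¹' w :=
    ⟨mem_extChartAt_target m₀, by rw [mem_preimage, extChartAt_to_inv]; exact hm₀⟩
  have hli : LinearIndependent ℝ fun i ↦ X' i (φ m₀) := by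
    have h := (hspan m₀ hm₀).1.map' (mfderiv 𝓘(ℝ, E) 𝓘(ℝ, E) φ m₀).toLinearMap
      (LinearMap.ker_eq_bot.2 (mfderiv_chart_injective (mem_extChartAt_source m₀)))
    have e : (fun i ↦ X' i (φ m₀)) = fun i ↦ (mfderiv 𝓘(ℝ, E) 𝓘(ℝ, E) φ m₀ (X i m₀) : E) :=
      funext fun i ↦ hX' i m₀ (mem_extChartAt_source m₀)
    rw [e]
    exact h
  obtain ⟨N, ℓ, u, hu, hyu, huw, hNs, hl, hr⟩ := exists_normalized_frame hopen hmem
    (fun i ↦ contDiffOn_chart_field m₀ hw (hX i)) hli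
  have hmi : ∀ m ∈ φ.source, φ m ∈ u → ∀ b : TangentSpace 𝓘(ℝ, E) m, b ∈ Δ m ↔
      N (φ m) (ℓ (mfderiv 𝓘(ℝ, E) 𝓘(ℝ, E) φ m b)) = mfderiv 𝓘(ℝ, E) 𝓘(ℝ, E) φ m b := by
    intro m hm hmu b
    have hmw : m ∈ w := by
      have := (huw hmu).2
      rwa [mem_preimage, φ.left_inv hm] at this
    have h1 : b ∈ Δ m ↔ (mfderiv 𝓘(ℝ, E) 𝓘(ℝ, E) φ m b : E) ∈ (N (φ m)).range := by
      have e : (fun i ↦ X' i (φ m)) = fun i ↦ (mfderiv 𝓘(ℝ, E) 𝓘(ℝ, E) φ m (X i m) : E) :=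
        funext fun i ↦ hX' i m hm
      rw [hr _ hmu, ← (hspan m hmw).2]
      change _ ↔ _ ∈ Submodule.span ℝ (range fun i ↦ X' i (φ m))
      rw [e]
      let A : E →L[ℝ] E := mfderiv 𝓘(ℝ, E) 𝓘(ℝ, E) φ m
      exact mem_span_range_iff_of_injective (f := A.toLinearMap) (mfderiv_chart_injective hm)
        (fun i ↦ (X i m : E)) b
    rw [h1]
    constructor
    · rintro ⟨a, ha⟩
      have ha' : N (φ m) a = mfderiv 𝓘(ℝ, E) 𝓘(ℝ, E) φ m b := ha
      rw [← ha', hl _ hmu]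
    · exact fun h ↦ ⟨_, h⟩
  have hmi' : ∀ m ∈ φ.source, φ m ∈ u → ∀ {b : TangentSpace 𝓘(ℝ, E) m} {e : E},
      mfderiv 𝓘(ℝ, E) 𝓘(ℝ, E) φ m b = e → N (φ m) (ℓ e) = e → b ∈ Δ m := by
    rintro m hm hmu b e rfl h
    exact (hmi m hm hmu b).2 h
  refine ⟨k, N, ℓ, u, hu, hyu, hNs, hl, hmi, fun y hy a b ↦ ?_⟩
  have hNy : DifferentiableAt ℝ N y :=
    (hNs.contDiffAt (hu.mem_nhds hy)).differentiableAt (by simp)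
  let P : (Fin k → ℝ) → ∀ m : M, TangentSpace 𝓘(ℝ, E) m := fun a ↦
    VectorField.mpullback 𝓘(ℝ, E) 𝓘(ℝ, E) φ (fun y ↦ N y a)
  have hNa : ∀ a, ContDiffOn ℝ ∞ (fun y ↦ N y a) u := fun a ↦ hNs.clm_apply contDiffOn_const
  have hNm : ∀ a, ∀ y ∈ u, ContMDiffAt 𝓘(ℝ, E) 𝓘(ℝ, E).tangent ∞
      (fun y ↦ (⟨y, N y a⟩ : TangentBundle 𝓘(ℝ, E) E)) y := fun a y hy ↦
    contMDiffAt_vectorSpace_iff_contDiffAt.2 ((hNa a).contDiffAt (hu.mem_nhds hy))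
  have hPs : ∀ a, ContMDiffOn 𝓘(ℝ, E) 𝓘(ℝ, E).tangent ∞
      (fun m ↦ (⟨m, P a m⟩ : TangentBundle 𝓘(ℝ, E) M)) (φ.source ∩ φ ⁻¹' u) := fun a m hm ↦
    (ContMDiffAt.mpullback_vectorField_preimage (m := ∞) (n := ∞) (hNm a _ hm.2)
      (contMDiffAt_chart hm.1) (isInvertible_mfderiv_chart hm.1) (by simp)).contMDiffWithinAt
  have hT : ∀ m ∈ φ.source, ∀ e : E, mfderiv 𝓘(ℝ, E) 𝓘(ℝ, E) φ m
      ((mfderiv 𝓘(ℝ, E) 𝓘(ℝ, E) φ m).inverse e) = e := fun m hm e ↦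
    ((isInvertible_mfderiv_chart hm).inverse_apply_eq.1 rfl).symm
  have hPΔ : ∀ a, ∀ m ∈ φ.source ∩ φ ⁻¹' u, P a m ∈ Δ m := by
    intro a m hm
    exact hmi' m hm.1 hm.2 (hT m hm.1 (N (φ m) a)) (by rw [hl _ hm.2])
  have hys : φ.symm y ∈ φ.source := φ.map_target (huw hy).1
  have hφy : φ (φ.symm y) = y := φ.right_inv (huw hy).1
  have hym : φ.symm y ∈ φ.source ∩ φ ⁻¹' u := ⟨hys, by rw [mem_preimage, hφy]; exact hy⟩
  have hbr := hI (φ.source ∩ φ ⁻¹' u) (P a) (P b)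
    ((continuousOn_extChartAt m₀).isOpen_inter_preimage (isOpen_extChartAt_source m₀) hu) (hPs a) (hPs b) (hPΔ a) (hPΔ b) _ hym
  have : IsManifold 𝓘(ℝ, E) (minSmoothness ℝ 2) M := by
    rw [minSmoothness_of_isRCLikeNormedField]
    exact IsManifold.of_le (n := ∞) (by exact ENat.LEInfty.out)
  have hcomm := VectorField.mpullback_mlieBracket (n := ∞) (x₀ := φ.symm y) (f := φ)
    (V := fun y ↦ N y a) (W := fun y ↦ N y b)
    ((hNm a _ hym.2).mdifferentiableAt (by simp)) ((hNm b _ hym.2).mdifferentiableAt (by simp))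
    (contMDiffAt_chart hys)
    (by rw [minSmoothness_of_isRCLikeNormedField]; exact ENat.LEInfty.out)
  let L : E := VectorField.mlieBracket 𝓘(ℝ, E) (fun y ↦ N y a) (fun y ↦ N y b) (φ (φ.symm y))
  have hTL : mfderiv 𝓘(ℝ, E) 𝓘(ℝ, E) φ (φ.symm y)
      (VectorField.mlieBracket 𝓘(ℝ, E) (P a) (P b) (φ.symm y)) = L := by
    refine Eq.trans ?_ (hT _ hys L)
    exact congrArg _ hcomm.symm
  -- Involutivity, carried to the chart: the bracket `L` of the frame fields is in the range of `N
  -- y`.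
  have hNL : N y (ℓ L) = L := by
    have h := (hmi _ hys hym.2 _).1 hbr
    rw [hφy] at h
    exact (congrArg (fun e ↦ N y (ℓ e)) hTL).symm.trans (h.trans hTL)
  have hfd : ∀ a v, fderiv ℝ (fun y ↦ N y a) y v = fderiv ℝ N y v a := fun a v ↦ by
    simp [fderiv_clm_apply hNy (differentiableAt_const a)]
  have hL : L = fderiv ℝ N y (N y a) b - fderiv ℝ N y (N y b) a := by
    rw [← hfd, ← hfd]
    simp only [L]
    refine (mlieBracket_eq_lieBracket _ _ _).trans ?_
    rw [hφy]
    rfl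
  -- Derivative of the constant function `y ↦ ℓ (N y a)`.
  have hℓ : ∀ a v, ℓ (fderiv ℝ N y v a) = 0 := fun a v ↦ by
    have h1 : HasFDerivAt (fun y ↦ ℓ (N y a)) (ℓ ∘L (fderiv ℝ N y).flip a) y := by
      have := (ℓ.hasFDerivAt.comp y (hNy.hasFDerivAt.clm_apply (hasFDerivAt_const a y)))
      simpa using this
    have h2 : HasFDerivAt (fun y ↦ ℓ (N y a)) (0 : E →L[ℝ] Fin k → ℝ) y := by
      refine (hasFDerivAt_const a y).congr_of_eventuallyEq ?_
      filter_upwards [hu.mem_nhds hy] with z hz using hl z hz a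
    exact DFunLike.congr_fun (h1.unique h2) v
  rw [← sub_eq_zero, ← hL, ← hNL, hL, map_sub, hℓ, hℓ, sub_zero, map_zero]

end Charts

/-! ### Foliated charts on the manifold. -/

section LeafCharts

open Set

variable {E : Type*} [NormedAddCommGroup E] [NormedSpace ℝ E]
  {M : Type*} [TopologicalSpace M] [ChartedSpace E M]

/-- A continuous map on an open set that distinguishes the local leaves of the distribution `Δ`. -/
structure LeafChart (Δ : ∀ m : M, Submodule ℝ (TangentSpace 𝓘(ℝ, E) m)) where
  /-- the domain -/
  source : Set M
  /-- the map that is constant on the local leaves -/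
  label : M → E
  isOpen : IsOpen source
  continuousOn : ContinuousOn label source
  hasDerivWithinAt : ∀ {c : ℝ → M} {s : Set ℝ} {t : ℝ}
    {c' : TangentSpace 𝓘(ℝ, ℝ) t →L[ℝ] TangentSpace 𝓘(ℝ, E) (c t)}, c t ∈ source →
    HasMFDerivWithinAt 𝓘(ℝ, ℝ) 𝓘(ℝ, E) c s t c' → c' (1 : ℝ) ∈ Δ (c t) →
    HasDerivWithinAt (fun t ↦ label (c t)) 0 s t
  tangent : ∀ {c : ℝ → M} {t : ℝ}
    {c' : TangentSpace 𝓘(ℝ, ℝ) t →L[ℝ] TangentSpace 𝓘(ℝ, E) (c t)}, c t ∈ source →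
    HasMFDerivAt 𝓘(ℝ, ℝ) 𝓘(ℝ, E) c t c' → (∀ᶠ t' in 𝓝 t, label (c t') = label (c t)) →
    c' (1 : ℝ) ∈ Δ (c t)
  exists_curve : ∀ m ∈ source, ∀ O ∈ 𝓝 m, ∃ u ∈ 𝓝 m, ∀ m' ∈ u, label m' = label m →
    ∃ c : ℝ → M, c 0 = m ∧ c 1 = m' ∧ ∀ t ∈ Icc (0 : ℝ) 1, c t ∈ O ∧
      ∃ c' : TangentSpace 𝓘(ℝ, ℝ) t →L[ℝ] TangentSpace 𝓘(ℝ, E) (c t),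
        HasMFDerivAt 𝓘(ℝ, ℝ) 𝓘(ℝ, E) c t c' ∧ c' (1 : ℝ) ∈ Δ (c t)

variable [IsManifold 𝓘(ℝ, E) ∞ M]

theorem hasDerivWithinAt_chart_comp {m₀ : M} {c : ℝ → M} {s : Set ℝ} {t : ℝ}
    {c' : TangentSpace 𝓘(ℝ, ℝ) t →L[ℝ] TangentSpace 𝓘(ℝ, E) (c t)}
    (hc : c t ∈ (extChartAt 𝓘(ℝ, E) m₀).source)
    (hd : HasMFDerivWithinAt 𝓘(ℝ, ℝ) 𝓘(ℝ, E) c s t c') :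
    HasDerivWithinAt (fun t ↦ extChartAt 𝓘(ℝ, E) m₀ (c t))
      (mfderiv 𝓘(ℝ, E) 𝓘(ℝ, E) (extChartAt 𝓘(ℝ, E) m₀) (c t) (c' (1 : ℝ)) : E) s t := by
  have h := (mdifferentiableAt_chart hc).hasMFDerivAt.comp_hasMFDerivWithinAt t hd
  let A : ℝ →L[ℝ] E := (mfderiv 𝓘(ℝ, E) 𝓘(ℝ, E) (extChartAt 𝓘(ℝ, E) m₀) (c t)).comp c'
  have h' : HasFDerivWithinAt (fun t ↦ extChartAt 𝓘(ℝ, E) m₀ (c t)) A s t := h.hasFDerivWithinAt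
  exact h'.hasDerivWithinAt

theorem hasMFDerivAt_chart_symm_comp {m₀ : M} {c : ℝ → E} {t : ℝ} {c' : E}
    (hc : c t ∈ (extChartAt 𝓘(ℝ, E) m₀).target) (hd : HasDerivAt c c' t) :
    ∃ d : TangentSpace 𝓘(ℝ, ℝ) t →L[ℝ]
        TangentSpace 𝓘(ℝ, E) ((extChartAt 𝓘(ℝ, E) m₀).symm (c t)),
      HasMFDerivAt 𝓘(ℝ, ℝ) 𝓘(ℝ, E) (fun t ↦ (extChartAt 𝓘(ℝ, E) m₀).symm (c t)) t d ∧
      d (1 : ℝ) = mfderiv 𝓘(ℝ, E) 𝓘(ℝ, E) (extChartAt 𝓘(ℝ, E) m₀).symm (c t) c' := by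
  have h := (mdifferentiableAt_chart_symm hc).hasMFDerivAt.comp t hd.hasFDerivAt.hasMFDerivAt
  refine ⟨_, h, ?_⟩
  change mfderiv 𝓘(ℝ, E) 𝓘(ℝ, E) (extChartAt 𝓘(ℝ, E) m₀).symm (c t) ((1 : ℝ) • c') = _
  rw [one_smul]

/-- Every point lies in the domain of a leaf chart of an involutive distribution. -/
theorem exists_leafChart [FiniteDimensional ℝ E]
    {Δ : ∀ m : M, Submodule ℝ (TangentSpace 𝓘(ℝ, E) m)} (hΔ : IsDistribution Δ)
    (hI : IsInvolutive Δ) (m₀ : M) : ∃ L : LeafChart Δ, m₀ ∈ L.source := by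
  have : CompleteSpace E := FiniteDimensional.complete ℝ E
  obtain ⟨k, N₀, ℓ, u, h⟩ := exists_isAdaptedFrame hΔ hI m₀
  set φ := extChartAt 𝓘(ℝ, E) m₀ with hφ
  have hu := h.isOpen.mem_nhds h.mem
  have hut : u ∩ φ.target ∈ 𝓝 (φ m₀) := Filter.inter_mem hu (extChartAt_target_mem_nhds m₀)
  obtain ⟨N, ρ, B, C, K, hN, hsub, heq⟩ := exists_commutingFrame hut
    ((h.contDiffOn.contDiffAt hu).of_le ENat.LEInfty.out)
    (Filter.mem_of_superset hu h.left_inv) (Filter.mem_of_superset hu h.comm)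
  have hmem : ∀ m ∈ φ.source ∩ φ ⁻¹' Metric.ball (φ m₀) ρ, ∀ b : TangentSpace 𝓘(ℝ, E) m, b ∈ Δ m ↔
      N (φ m) (ℓ (mfderiv 𝓘(ℝ, E) 𝓘(ℝ, E) φ m b)) = mfderiv 𝓘(ℝ, E) 𝓘(ℝ, E) φ m b := by
    intro m hm b
    rw [heq _ hm.2]
    exact h.mem_iff m hm.1 (hsub hm.2).1 b
  have hcs : φ.source ∩ φ ⁻¹' hN.core ⊆ φ.source ∩ φ ⁻¹' Metric.ball (φ m₀) ρ :=
    inter_subset_inter_right _ (preimage_mono hN.core_subset)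
  refine ⟨⟨φ.source ∩ φ ⁻¹' hN.core, fun m ↦ hN.label (φ m),
    (continuousOn_extChartAt m₀).isOpen_inter_preimage (isOpen_extChartAt_source m₀)
      hN.isOpen_core, ?_, ?_, ?_, ?_⟩, mem_extChartAt_source m₀, hN.mem_core⟩
  · intro m hm
    exact ((hN.continuousAt_label hm.2).comp
      (continuousAt_extChartAt' hm.1)).continuousWithinAt
  · intro c s t c' hc hd hc'
    exact hN.hasDerivWithinAt_label (c := fun t ↦ φ (c t)) hc.2 (hasDerivWithinAt_chart_comp hc.1 hd)
      ((hmem _ (hcs hc) _).1 hc')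
  · intro c t c' hc hd hl
    have hd' := hasDerivWithinAt_univ.1
      (hasDerivWithinAt_chart_comp hc.1 hd.hasMFDerivWithinAt (s := univ))
    exact (hmem _ (hcs hc) _).2 (hN.tangent_of_label_eq (c := fun t ↦ φ (c t)) hc.2 hd' hl)
  · intro m hm O hO
    have hO' : φ.symm ⁻¹' O ∩ Metric.ball (φ m₀) ρ ∈ 𝓝 (φ m) := by
      refine Filter.inter_mem ?_ (Metric.isOpen_ball.mem_nhds (hcs hm).2)
      exact (contMDiffAt_chart_symm (φ.map_source hm.1)).continuousAt.preimage_mem_nhds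
        (by rwa [φ.left_inv hm.1])
    obtain ⟨w, hw, hcurve⟩ := hN.exists_tangent_curve hm.2 hO'
    refine ⟨φ.source ∩ φ ⁻¹' w, Filter.inter_mem ((isOpen_extChartAt_source m₀).mem_nhds hm.1)
      ((continuousAt_extChartAt' hm.1).preimage_mem_nhds hw), fun m' hm' hl ↦ ?_⟩
    obtain ⟨c, a, h0, h1, hc⟩ := hcurve (φ m') hm'.2 hl
    refine ⟨fun t ↦ φ.symm (c t), ?_, ?_, fun t ht ↦ ⟨(hc t ht).1.1, ?_⟩⟩
    · simp only [h0]
      exact φ.left_inv hm.1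
    · simp only [h1]
      exact φ.left_inv hm'.1
    · have hct := (hc t ht).1.2
      have hctt := (hsub hct).2
      obtain ⟨d, hd, hd1⟩ := hasMFDerivAt_chart_symm_comp hctt (hc t ht).2
      refine ⟨d, hd, (hmem (φ.symm (c t)) ⟨φ.map_target hctt, ?_⟩ _).2 ?_⟩
      · rw [mem_preimage, φ.right_inv hctt]
        exact hct
      · have e : mfderiv 𝓘(ℝ, E) 𝓘(ℝ, E) φ (φ.symm (c t)) (d (1 : ℝ)) = N (c t) a := by
          rw [hd1]
          have := mfderiv_chart_apply (φ.map_target hctt) (N (c t) a)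
          rwa [φ.right_inv hctt] at this
        have e' := hN.left_inv _ hct a
        generalize (mfderiv 𝓘(ℝ, E) 𝓘(ℝ, E) φ (φ.symm (c t)) (d (1 : ℝ))) = x at e ⊢
        rw [φ.right_inv hctt]
        exact (congrArg (fun x ↦ N (c t) (ℓ x)) e).trans ((congrArg _ e').trans e.symm)

end LeafCharts

/-! ### Global leaves and the countability of their local leaves. -/

section Leaves

open Set

variable {E : Type*} [NormedAddCommGroup E] [NormedSpace ℝ E]
  {M : Type*} [TopologicalSpace M] [ChartedSpace E M]
  {Δ : ∀ m : M, Submodule ℝ (TangentSpace 𝓘(ℝ, E) m)}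

/-- The curve `c` is differentiable within `s`, with derivative in `Δ`. -/
def IsTangentOn (Δ : ∀ m : M, Submodule ℝ (TangentSpace 𝓘(ℝ, E) m)) (c : ℝ → M) (s : Set ℝ) :
    Prop :=
  ∀ t ∈ s, ∃ c' : TangentSpace 𝓘(ℝ, ℝ) t →L[ℝ] TangentSpace 𝓘(ℝ, E) (c t),
    HasMFDerivWithinAt 𝓘(ℝ, ℝ) 𝓘(ℝ, E) c s t c' ∧ c' (1 : ℝ) ∈ Δ (c t)

theorem IsTangentOn.mono {c : ℝ → M} {s s' : Set ℝ} (h : IsTangentOn Δ c s) (hs : s' ⊆ s) :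
    IsTangentOn Δ c s' := fun t ht ↦
  let ⟨c', h1, h2⟩ := h t (hs ht)
  ⟨c', h1.mono hs, h2⟩

theorem LeafChart.label_eq_of_isTangentOn (L : LeafChart Δ) {c : ℝ → M} {a b : ℝ} (hab : a ≤ b)
    (hc : IsTangentOn Δ c (Icc a b)) (hs : ∀ t ∈ Icc a b, c t ∈ L.source) :
    L.label (c a) = L.label (c b) := by
  have h := norm_image_sub_le_of_norm_deriv_le_segment' (f := fun t ↦ L.label (c t)) (C := 0)
    (f' := fun _ ↦ 0) (a := a) (b := b) (fun t ht ↦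
      let ⟨_, h1, h2⟩ := hc t ht
      L.hasDerivWithinAt (hs t ht) h1 h2) (by simp) b ⟨hab, le_rfl⟩
  simp only [zero_mul, norm_le_zero_iff, sub_eq_zero] at h
  exact h.symm

/-- A local leaf of one leaf chart meets only countably many local leaves of another one. -/
theorem LeafChart.countable_label_image [SecondCountableTopology M] (L L' : LeafChart Δ) (z : E) :
    (L'.label '' {m | m ∈ L.source ∧ m ∈ L'.source ∧ L.label m = z}).Countable := by
  set P := {m | m ∈ L.source ∧ m ∈ L'.source ∧ L.label m = z} with hP
  -- On `P`, in the subspace topology of `M`, the second label is locally constant: nearby points of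
  -- `P` are joined by a tangent curve inside `L'.source`. A countable subcover then leaves
  -- countably many values.
  have h : ∀ m ∈ P, ∃ u ∈ 𝓝[P] m, ∀ m' ∈ u, L'.label m' = L'.label m := by
    intro m hm
    obtain ⟨u, hu, hcurve⟩ := L.exists_curve m hm.1 L'.source (L'.isOpen.mem_nhds hm.2.1)
    refine ⟨u ∩ P, Filter.inter_mem (mem_nhdsWithin_of_mem_nhds hu) self_mem_nhdsWithin,
      fun m' hm' ↦ ?_⟩
    obtain ⟨c, h0, h1, hc⟩ := hcurve m' hm'.1 (hm'.2.2.2.trans hm.2.2.symm)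
    have := L'.label_eq_of_isTangentOn (c := c) zero_le_one (fun t ht ↦
      let ⟨c', hd, hd1⟩ := (hc t ht).2
      ⟨c', hd.hasMFDerivWithinAt, hd1⟩) (fun t ht ↦ (hc t ht).1)
    rw [h0, h1] at this
    exact this.symm
  choose! u hu hul using h
  obtain ⟨t, htP, htc, htU⟩ := TopologicalSpace.countable_cover_nhdsWithin hu
  refine (htc.image L'.label).mono ?_
  rintro _ ⟨m, hm, rfl⟩
  obtain ⟨m₁, hm₁, hmu⟩ := mem_iUnion₂.1 (htU hm)
  exact ⟨m₁, hm₁, (hul m₁ (htP hm₁) m hmu).symm⟩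

/-- The local leaves, given by a leaf chart and a label, that are met by a chain of `n` local leaves
starting from the local leaf `p`. -/
def leafChain {ι : Type*} (L : ι → LeafChart Δ) (p : ι × E) : ℕ → Set (ι × E)
  | 0 => {p}
  | n + 1 => ⋃ q ∈ leafChain L p n, ⋃ j, (fun z ↦ (j, z)) ''
      ((L j).label '' {m | m ∈ (L q.1).source ∧ m ∈ (L j).source ∧ (L q.1).label m = q.2})

theorem countable_leafChain [SecondCountableTopology M] {ι : Type*} [Countable ι]
    (L : ι → LeafChart Δ) (p : ι × E) (n : ℕ) : (leafChain L p n).Countable := by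
  induction n with
  | zero => exact countable_singleton p
  | succ n ih => exact ih.biUnion fun q _ ↦ countable_iUnion fun j ↦
      ((L q.1).countable_label_image (L j) q.2).image _

/-- The union of the local leaves that can be joined to the local leaf `p`. -/
def leaf {ι : Type*} (L : ι → LeafChart Δ) (p : ι × E) : Set M :=
  {m | ∃ i n, m ∈ (L i).source ∧ (i, (L i).label m) ∈ leafChain L p n}

/-- Membership does not depend on the chart used to test it: passing to another chart containing `m`
costs one more link of the chain. -/
theorem mem_leaf_iff {ι : Type*} (L : ι → LeafChart Δ) (p : ι × E) {i : ι} {m : M}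
    (hm : m ∈ (L i).source) : m ∈ leaf L p ↔ ∃ n, (i, (L i).label m) ∈ leafChain L p n := by
  refine ⟨fun ⟨j, n, hj, hn⟩ ↦ ⟨n + 1, ?_⟩, fun ⟨n, hn⟩ ↦ ⟨i, n, hm, hn⟩⟩
  exact mem_biUnion hn (mem_iUnion.2 ⟨i, _, ⟨m, ⟨hj, hm, rfl⟩, rfl⟩, rfl⟩)

theorem countable_label_leaf [SecondCountableTopology M] {ι : Type*} [Countable ι]
    (L : ι → LeafChart Δ) (p : ι × E) (i : ι) :
    ((L i).label '' ((L i).source ∩ leaf L p)).Countable := by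
  refine ((countable_iUnion (countable_leafChain L p)).image Prod.snd).mono ?_
  rintro _ ⟨m, ⟨hm, hl⟩, rfl⟩
  obtain ⟨n, hn⟩ := (mem_leaf_iff L p hm).1 hl
  exact ⟨_, mem_iUnion.2 ⟨n, hn⟩, rfl⟩

/-- Locally the curve stays in one leaf chart, where its label is constant; connectedness of the
interval makes this global. -/
theorem IsTangentOn.mem_leaf_iff {ι : Type*} {L : ι → LeafChart Δ}
    (hL : ∀ m, ∃ i, m ∈ (L i).source) (p : ι × E) {c : ℝ → M} {a b : ℝ} (hab : a ≤ b)
    (hc : IsTangentOn Δ c (Icc a b)) : c a ∈ leaf L p ↔ c b ∈ leaf L p := by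
  refine isPreconnected_Icc.induction₂ (s := Icc a b) (fun s t ↦ c s ∈ leaf L p ↔ c t ∈ leaf L p)
    (fun s hs ↦ ?_) (fun _ _ _ _ _ _ h1 h2 ↦ h1.trans h2) (fun _ _ _ _ h ↦ h.symm) (left_mem_Icc.2 hab)
    (right_mem_Icc.2 hab)
  obtain ⟨i, hi⟩ := hL (c s)
  obtain ⟨c', hd, -⟩ := hc s hs
  obtain ⟨ε, hε, hball⟩ := Metric.mem_nhdsWithin_iff.1
    (hd.continuousWithinAt.preimage_mem_nhdsWithin ((L i).isOpen.mem_nhds hi))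
  filter_upwards [inter_mem_nhdsWithin (Icc a b) (Metric.ball_mem_nhds s hε)] with t ht
  have hsub : uIcc s t ⊆ Metric.ball s ε ∩ Icc a b := by
    refine subset_inter ?_ (ordConnected_Icc.uIcc_subset hs ht.1)
    rw [← segment_eq_uIcc]
    exact (convex_ball s ε).segment_subset (Metric.mem_ball_self hε) ht.2
  have hlab : (L i).label (c s) = (L i).label (c t) := by
    rcases le_total s t with h | h
    · rw [uIcc_of_le h] at hsub
      exact (L i).label_eq_of_isTangentOn h (hc.mono (hsub.trans inter_subset_right))
        fun r hr ↦ hball (hsub hr)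
    · rw [uIcc_of_ge h] at hsub
      exact ((L i).label_eq_of_isTangentOn h (hc.mono (hsub.trans inter_subset_right))
        fun r hr ↦ hball (hsub hr)).symm
  rw [DiscreteMechanics.mem_leaf_iff L p hi,
    DiscreteMechanics.mem_leaf_iff L p (hball ⟨ht.2, ht.1⟩), hlab]

theorem Reachable.mem_leaf_iff {ι : Type*} {L : ι → LeafChart Δ}
    (hL : ∀ m, ∃ i, m ∈ (L i).source) (p : ι × E) {m m' : M} (h : Reachable Δ m m') :
    m ∈ leaf L p ↔ m' ∈ leaf L p := by
  obtain ⟨c, n, t, rfl, rfl, hc⟩ := h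
  have : ∀ k ≤ n, (c (t 0) ∈ leaf L p ↔ c (t k) ∈ leaf L p) := by
    intro k
    induction k with
    | zero => exact fun _ ↦ Iff.rfl
    | succ k ih =>
      intro hk
      obtain ⟨hlt, hs, hd⟩ := hc k (by omega)
      refine (ih (by omega)).trans (IsTangentOn.mem_leaf_iff hL p hlt.le fun s hs' ↦ ?_)
      exact ⟨_, ((hs s hs').mdifferentiableWithinAt (by simp)).hasMFDerivWithinAt, hd s hs'⟩
  exact this n le_rfl

/-- A differentiable curve in a leaf is tangent to the distribution. -/
theorem tangent_of_forall_mem_leaf [SecondCountableTopology M] {ι : Type*} [Countable ι]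
    {L : ι → LeafChart Δ} (hL : ∀ m, ∃ i, m ∈ (L i).source) (p : ι × E) {c : ℝ → M} {t : ℝ}
    {c' : TangentSpace 𝓘(ℝ, ℝ) t →L[ℝ] TangentSpace 𝓘(ℝ, E) (c t)}
    (hd : HasMFDerivAt 𝓘(ℝ, ℝ) 𝓘(ℝ, E) c t c')
    (hc : ∀ᶠ s in 𝓝 t, ContinuousAt c s ∧ c s ∈ leaf L p) : c' (1 : ℝ) ∈ Δ (c t) := by
  obtain ⟨i, hi⟩ := hL (c t)
  have hev : ∀ᶠ s in 𝓝 t, c s ∈ (L i).source ∧ ContinuousAt c s ∧ c s ∈ leaf L p :=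
    (hd.continuousAt.eventually ((L i).isOpen.mem_nhds hi)).and hc
  obtain ⟨ε, hε, hball⟩ := Metric.eventually_nhds_iff_ball.1 hev
  refine (L i).tangent hi hd ?_
  filter_upwards [Metric.ball_mem_nhds t hε] with s hs
  have hcont : ContinuousOn (fun s ↦ (L i).label (c s)) (Metric.ball t ε) := fun s hs ↦
    (((L i).continuousOn.continuousAt ((L i).isOpen.mem_nhds (hball s hs).1)).comp
      (hball s hs).2.1).continuousWithinAt
  -- The labels along the curve form a connected subset of a countable set, hence a single point.
  refine (countable_label_leaf L p i).isTotallyDisconnected _ ?_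
    ((convex_ball t ε).isPreconnected.image _ hcont) (mem_image_of_mem _ hs)
    (mem_image_of_mem _ (Metric.mem_ball_self hε))
  rintro _ ⟨s, hs, rfl⟩
  exact ⟨c s, ⟨(hball s hs).1, (hball s hs).2.2⟩, rfl⟩

theorem exists_countable_leafCharts [FiniteDimensional ℝ E] [IsManifold 𝓘(ℝ, E) ∞ M]
    [SecondCountableTopology M] (hΔ : IsDistribution Δ) (hI : IsInvolutive Δ) :
    ∃ (T : Set M) (L : T → LeafChart Δ), T.Countable ∧ ∀ m, ∃ i, m ∈ (L i).source := by
  choose L hL using exists_leafChart hΔ hI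
  obtain ⟨T, hT, hU⟩ := TopologicalSpace.countable_cover_nhds
    fun m ↦ (L m).isOpen.mem_nhds (hL m)
  refine ⟨T, fun m ↦ L m, hT, fun m ↦ ?_⟩
  have : m ∈ ⋃ x ∈ T, (L x).source := hU ▸ mem_univ m
  obtain ⟨x, hx, hm⟩ := mem_iUnion₂.1 this
  exact ⟨⟨x, hx⟩, hm⟩

/-- If every point of a differentiable curve `b` can be reached from the corresponding point of a
curve `c` tangent to an involutive distribution, then `b` is tangent to the distribution. -/
theorem tangent_of_forall_reachable [FiniteDimensional ℝ E] [IsManifold 𝓘(ℝ, E) ∞ M]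
    [SecondCountableTopology M] (hΔ : IsDistribution Δ) (hI : IsInvolutive Δ) {b c : ℝ → M} {ε : ℝ}
    (hε : 0 < ε) (hc : IsTangentOn Δ c (Ioo (-ε) ε)) (hb : ContinuousOn b (Ioo (-ε) ε))
    {b' : TangentSpace 𝓘(ℝ, ℝ) (0 : ℝ) →L[ℝ] TangentSpace 𝓘(ℝ, E) (b 0)}
    (hd : HasMFDerivAt 𝓘(ℝ, ℝ) 𝓘(ℝ, E) b 0 b')
    (h : ∀ t ∈ Ioo (-ε) ε, Reachable Δ (c t) (b t)) : b' (1 : ℝ) ∈ Δ (b 0) := by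
  obtain ⟨T, L, hT, hL⟩ := exists_countable_leafCharts hΔ hI
  have := hT.to_subtype
  obtain ⟨i, hi⟩ := hL (c 0)
  let p : T × E := (i, (L i).label (c 0))
  have hp : c 0 ∈ leaf L p := (mem_leaf_iff L p hi).2 ⟨0, rfl⟩
  have h0 : (0 : ℝ) ∈ Ioo (-ε) ε := ⟨by linarith, hε⟩
  refine tangent_of_forall_mem_leaf hL p hd ?_
  filter_upwards [isOpen_Ioo.mem_nhds h0] with t ht
  refine ⟨hb.continuousAt (isOpen_Ioo.mem_nhds ht), ((h t ht).mem_leaf_iff hL p).1 ?_⟩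
  rcases le_total 0 t with h' | h'
  · exact (IsTangentOn.mem_leaf_iff hL p h'
      (hc.mono (ordConnected_Ioo.out h0 ht))).1 hp
  · exact (IsTangentOn.mem_leaf_iff hL p h'
      (hc.mono (ordConnected_Ioo.out ht h0))).2 hp

end Leaves

/-! ### Lifting vector fields along submersions. -/

section Lifts

open Set

variable {E₁ F E : Type*} [NormedAddCommGroup E₁] [NormedSpace ℝ E₁]
  [NormedAddCommGroup F] [NormedSpace ℝ F] [NormedAddCommGroup E] [NormedSpace ℝ E]

/-- Vector fields of the form `N(·)a` lift along submersions. -/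
theorem exists_lift_field [FiniteDimensional ℝ E] {f : F → E} {x₀ : F} (hf : ContDiffAt ℝ 2 f x₀)
    (hs : Function.Surjective (fderiv ℝ f x₀)) {N : E → E₁ →L[ℝ] E}
    (hN : ContDiffAt ℝ 1 N (f x₀)) {w : F} {a : E₁} (hw : fderiv ℝ f x₀ w = N (f x₀) a) :
    ∃ Y : F → F, ContDiffAt ℝ 1 Y x₀ ∧ Y x₀ = w ∧
      ∀ᶠ y in 𝓝 x₀, fderiv ℝ f y (Y y) = N (f y) a := by
  have : CompleteSpace E := FiniteDimensional.complete ℝ E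
  obtain ⟨g, hg⟩ := (fderiv ℝ f x₀).toLinearMap.exists_rightInverse_of_surjective
    (LinearMap.range_eq_top.2 hs)
  let s : E →L[ℝ] F := LinearMap.toContinuousLinearMap g
  let G : F → E →L[ℝ] E := fun y ↦ fderiv ℝ f y ∘L s
  have hG₀ : G x₀ = 1 := by
    ext1 e
    exact LinearMap.congr_fun hg e
  have hf' : ContDiffAt ℝ 1 (fderiv ℝ f) x₀ := hf.fderiv_right (by norm_num)
  have hG : ContDiffAt ℝ 1 G x₀ := hf'.clm_comp contDiffAt_const
  have hinv : ContDiffAt ℝ 1 (fun y ↦ Ring.inverse (G y)) x₀ := by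
    have h := contDiffAt_ringInverse ℝ (n := 1) (1 : (E →L[ℝ] E)ˣ)
    rw [Units.val_one, ← hG₀] at h
    exact h.comp x₀ hG
  -- The constant field `w` is corrected through the right inverse `s` of the derivative at `x₀`; `G
  -- y`, the derivative at `y` composed with `s`, is invertible near `x₀`. At `x₀` the correction is
  -- zero by `hw`.
  refine ⟨fun y ↦ w + s (Ring.inverse (G y) (N (f y) a - fderiv ℝ f y w)), ?_, ?_, ?_⟩
  · exact contDiffAt_const.add (s.contDiff.contDiffAt.comp x₀ (hinv.clm_apply
      (((hN.comp x₀ (hf.of_le (by norm_num))).clm_apply contDiffAt_const).sub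
        (hf'.clm_apply contDiffAt_const))))
  · simp [hw]
  · have hu : ∀ᶠ y in 𝓝 x₀, IsUnit (G y) :=
      hG.continuousAt.eventually (Units.isOpen.mem_nhds (by simp [hG₀]))
    filter_upwards [hu] with y hy
    have h := DFunLike.congr_fun (Ring.mul_inverse_cancel (G y) hy) (N (f y) a - fderiv ℝ f y w)
    change fderiv ℝ f y (s (Ring.inverse (G y) (N (f y) a - fderiv ℝ f y w))) = _ at h
    rw [map_add, h]
    simp

end Lifts

/-! ### Tangency to the leaves along a submersion. -/

section Submersions

open Set

variable {E : Type*} [NormedAddCommGroup E] [NormedSpace ℝ E]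
  {M : Type*} [TopologicalSpace M] [ChartedSpace E M]
  {F : Type*} [NormedAddCommGroup F] [NormedSpace ℝ F]
  {D : Type*} [TopologicalSpace D] [ChartedSpace F D]

/-- All tangent spaces are the model space by definition, so a vector can be moved along an equality
of base points. This and `mfderiv_apply_congr` avoid dependent rewriting. -/
theorem mem_distribution_congr (Δ : ∀ m : M, Submodule ℝ (TangentSpace 𝓘(ℝ, E) m)) {m m' : M}
    (h : m = m') {v v' : E} (hv : v = v') (hm : v ∈ (Δ m : Submodule ℝ E)) :
    v' ∈ (Δ m' : Submodule ℝ E) := by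
  subst h hv
  exact hm

theorem mfderiv_apply_congr (g : D → M) {x x' : D} (h : x = x') {v v' : F} (hv : v = v') :
    (mfderiv 𝓘(ℝ, F) 𝓘(ℝ, E) g x v : E) = mfderiv 𝓘(ℝ, F) 𝓘(ℝ, E) g x' v' := by
  subst h hv
  rfl

/-- The local representative of a map in the preferred charts at `x` and at `m₀`. -/
def chartMap (g : D → M) (x : D) (m₀ : M) (y : F) : E :=
  extChartAt 𝓘(ℝ, E) m₀ (g ((extChartAt 𝓘(ℝ, F) x).symm y))

variable [IsManifold 𝓘(ℝ, E) ∞ M] [IsManifold 𝓘(ℝ, F) ∞ D]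

theorem contDiffAt_chartMap {g : D → M} {x : D} {m₀ : M} {y : F}
    (hy : y ∈ (extChartAt 𝓘(ℝ, F) x).target)
    (hg : ContMDiffAt 𝓘(ℝ, F) 𝓘(ℝ, E) ∞ g ((extChartAt 𝓘(ℝ, F) x).symm y))
    (hs : g ((extChartAt 𝓘(ℝ, F) x).symm y) ∈ (extChartAt 𝓘(ℝ, E) m₀).source) :
    ContDiffAt ℝ ∞ (chartMap g x m₀ : F → E) y :=
  contMDiffAt_iff_contDiffAt.1
    ((contMDiffAt_chart hs).comp y (hg.comp y (contMDiffAt_chart_symm hy)))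

theorem fderiv_chartMap {g : D → M} {x : D} {m₀ : M} {y : F}
    (hy : y ∈ (extChartAt 𝓘(ℝ, F) x).target)
    (hg : MDifferentiableAt 𝓘(ℝ, F) 𝓘(ℝ, E) g ((extChartAt 𝓘(ℝ, F) x).symm y))
    (hs : g ((extChartAt 𝓘(ℝ, F) x).symm y) ∈ (extChartAt 𝓘(ℝ, E) m₀).source) (k : F) :
    fderiv ℝ (chartMap g x m₀ : F → E) y k =
      mfderiv 𝓘(ℝ, E) 𝓘(ℝ, E) (extChartAt 𝓘(ℝ, E) m₀) (g ((extChartAt 𝓘(ℝ, F) x).symm y))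
        (mfderiv 𝓘(ℝ, F) 𝓘(ℝ, E) g ((extChartAt 𝓘(ℝ, F) x).symm y)
          (mfderiv 𝓘(ℝ, F) 𝓘(ℝ, F) (extChartAt 𝓘(ℝ, F) x).symm y k)) := by
  have h := (mdifferentiableAt_chart hs).hasMFDerivAt.comp y
    (hg.hasMFDerivAt.comp y (mdifferentiableAt_chart_symm hy).hasMFDerivAt)
  let A : F →L[ℝ] E := (mfderiv 𝓘(ℝ, E) 𝓘(ℝ, E) (extChartAt 𝓘(ℝ, E) m₀)
    (g ((extChartAt 𝓘(ℝ, F) x).symm y))).comp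
      ((mfderiv 𝓘(ℝ, F) 𝓘(ℝ, E) g ((extChartAt 𝓘(ℝ, F) x).symm y)).comp
        (mfderiv 𝓘(ℝ, F) 𝓘(ℝ, F) (extChartAt 𝓘(ℝ, F) x).symm y))
  have h' : HasFDerivAt (chartMap g x m₀ : F → E) A y := h.hasFDerivAt
  rw [h'.fderiv]
  rfl

theorem contDiffAt_chartMap_self {g : D → M} {x : D} (hg : ContMDiffAt 𝓘(ℝ, F) 𝓘(ℝ, E) ∞ g x) :
    ContDiffAt ℝ ∞ (chartMap g x (g x) : F → E) (extChartAt 𝓘(ℝ, F) x x) := by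
  have hx : (extChartAt 𝓘(ℝ, F) x).symm (extChartAt 𝓘(ℝ, F) x x) = x := extChartAt_to_inv x
  exact contDiffAt_chartMap (mem_extChartAt_target x) (by rwa [hx])
    (by rw [hx]; exact mem_extChartAt_source _)

omit [IsManifold 𝓘(ℝ, E) ∞ M] [IsManifold 𝓘(ℝ, F) ∞ D] in
theorem chartMap_self (g : D → M) (x : D) :
    (chartMap g x (g x) (extChartAt 𝓘(ℝ, F) x x) : E) = extChartAt 𝓘(ℝ, E) (g x) (g x) := by
  have hx : (extChartAt 𝓘(ℝ, F) x).symm (extChartAt 𝓘(ℝ, F) x x) = x := extChartAt_to_inv x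
  rw [chartMap, hx]

theorem fderiv_chartMap_self {g : D → M} {x : D} (hg : MDifferentiableAt 𝓘(ℝ, F) 𝓘(ℝ, E) g x)
    (v : TangentSpace 𝓘(ℝ, F) x) :
    fderiv ℝ (chartMap g x (g x) : F → E) (extChartAt 𝓘(ℝ, F) x x)
      (mfderiv 𝓘(ℝ, F) 𝓘(ℝ, F) (extChartAt 𝓘(ℝ, F) x) x v) =
      mfderiv 𝓘(ℝ, E) 𝓘(ℝ, E) (extChartAt 𝓘(ℝ, E) (g x)) (g x)
        (mfderiv 𝓘(ℝ, F) 𝓘(ℝ, E) g x v) := by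
  have hx : (extChartAt 𝓘(ℝ, F) x).symm (extChartAt 𝓘(ℝ, F) x x) = x := extChartAt_to_inv x
  refine (fderiv_chartMap (mem_extChartAt_target x) (by rwa [hx])
    (by rw [hx]; exact mem_extChartAt_source _) _).trans ?_
  refine mfderiv_apply_congr _ (by rw [hx]) (mfderiv_apply_congr _ hx ?_)
  exact mfderiv_chart_symm_apply (mem_extChartAt_source x) v

/-- In charts, the lift of `N(·)a` along a submersion `g`, through a given vector `w` such that
`Tg(w) ∈ Δ`. -/
theorem exists_lift_field_chart [FiniteDimensional ℝ E]
    {Δ : ∀ m : M, Submodule ℝ (TangentSpace 𝓘(ℝ, E) m)}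
    {g : D → M} {x : D} (hg : ContMDiffAt 𝓘(ℝ, F) 𝓘(ℝ, E) ∞ g x)
    (hsurj : Function.Surjective (mfderiv 𝓘(ℝ, F) 𝓘(ℝ, E) g x)) {k : ℕ}
    {N : E → (Fin k → ℝ) →L[ℝ] E} {ℓ : E →L[ℝ] Fin k → ℝ} {u : Set E}
    (h : IsAdaptedFrame Δ (g x) N ℓ u) {w : TangentSpace 𝓘(ℝ, F) x}
    (hw : mfderiv 𝓘(ℝ, F) 𝓘(ℝ, E) g x w ∈ Δ (g x)) :
    ∃ (Y : F → F) (a : Fin k → ℝ), ContDiffAt ℝ 1 Y (extChartAt 𝓘(ℝ, F) x x) ∧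
      Y (extChartAt 𝓘(ℝ, F) x x) =
        mfderiv 𝓘(ℝ, F) 𝓘(ℝ, F) (extChartAt 𝓘(ℝ, F) x) x w ∧
      ∀ᶠ y in 𝓝 (extChartAt 𝓘(ℝ, F) x x), fderiv ℝ (chartMap g x (g x) : F → E) y (Y y) =
        N (chartMap g x (g x) y) a := by
  set y₀ := extChartAt 𝓘(ℝ, F) x x with hy₀
  have hf := contDiffAt_chartMap_self hg
  have hfy : (chartMap g x (g x) y₀ : E) = extChartAt 𝓘(ℝ, E) (g x) (g x) := chartMap_self g x
  have hfd := fderiv_chartMap_self (hg.mdifferentiableAt (by simp))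
  have hmem := (h.mem_iff (g x) (mem_extChartAt_source _) h.mem _).1 hw
  have hfs : Function.Surjective (fderiv ℝ (chartMap g x (g x) : F → E) y₀) := by
    intro e
    obtain ⟨v, hv⟩ := hsurj (mfderiv 𝓘(ℝ, E) 𝓘(ℝ, E) (extChartAt 𝓘(ℝ, E) (g x)).symm
      (extChartAt 𝓘(ℝ, E) (g x) (g x)) e)
    refine ⟨mfderiv 𝓘(ℝ, F) 𝓘(ℝ, F) (extChartAt 𝓘(ℝ, F) x) x v, (hfd v).trans ?_⟩
    exact (congrArg _ hv).trans (mfderiv_chart_apply (mem_extChartAt_source _) e)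
  have hN : ContDiffAt ℝ 1 N (chartMap g x (g x) y₀) := by
    rw [hfy]
    exact (h.contDiffOn.contDiffAt (h.isOpen.mem_nhds h.mem)).of_le ENat.LEInfty.out
  have hfw : fderiv ℝ (chartMap g x (g x) : F → E) y₀
      (mfderiv 𝓘(ℝ, F) 𝓘(ℝ, F) (extChartAt 𝓘(ℝ, F) x) x w) = N (chartMap g x (g x) y₀)
      (ℓ (mfderiv 𝓘(ℝ, E) 𝓘(ℝ, E) (extChartAt 𝓘(ℝ, E) (g x)) (g x)
        (mfderiv 𝓘(ℝ, F) 𝓘(ℝ, E) g x w))) := by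
    rw [hfy]
    exact (hfd w).trans hmem.symm
  obtain ⟨Y, h1, h2, h3⟩ := exists_lift_field (hf.of_le ENat.LEInfty.out) hfs hN hfw
  exact ⟨Y, _, h1, h2, h3⟩

/-- If `h(y)` can always be reached from `g(y)`, where `g` is a submersion, then `Tg(w) ∈ Δ` implies
`Th(w) ∈ Δ`. -/
theorem mfderiv_mem_of_reachable [FiniteDimensional ℝ E] [FiniteDimensional ℝ F]
    [SecondCountableTopology M] {Δ : ∀ m : M, Submodule ℝ (TangentSpace 𝓘(ℝ, E) m)}
    (hΔ : IsDistribution Δ) (hI : IsInvolutive Δ) {g h : D → M}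
    (hg : ContMDiff 𝓘(ℝ, F) 𝓘(ℝ, E) ∞ g) (hh : ContMDiff 𝓘(ℝ, F) 𝓘(ℝ, E) ∞ h)
    (hgh : ∀ y, Reachable Δ (g y) (h y)) {x : D}
    (hsurj : Function.Surjective (mfderiv 𝓘(ℝ, F) 𝓘(ℝ, E) g x)) {w : TangentSpace 𝓘(ℝ, F) x}
    (hw : mfderiv 𝓘(ℝ, F) 𝓘(ℝ, E) g x w ∈ Δ (g x)) :
    mfderiv 𝓘(ℝ, F) 𝓘(ℝ, E) h x w ∈ Δ (h x) := by
  have : CompleteSpace F := FiniteDimensional.complete ℝ F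
  obtain ⟨k, N, ℓ, u, hfr⟩ := exists_isAdaptedFrame hΔ hI (g x)
  obtain ⟨Y, a, hY, hY₀, hYl⟩ := exists_lift_field_chart (hg x) hsurj hfr hw
  set ψ := extChartAt 𝓘(ℝ, F) x with hψ
  set φ := extChartAt 𝓘(ℝ, E) (g x) with hφ
  have hx : ψ.symm (ψ x) = x := extChartAt_to_inv x
  -- The integral curve of the lift `Y`: its velocity at `0` represents `w`, and `g` maps it to an
  -- integral curve of `N(·)a`, which is tangent to `Δ`.
  obtain ⟨α, hα0, ε, hε, hα⟩ :=
    hY.exists_forall_mem_closedBall_exists_eq_forall_mem_Ioo_hasDerivAt₀ 0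
  have h0 : (0 : ℝ) ∈ Ioo (0 - ε) (0 + ε) := by simp [hε]
  have hψc : ContinuousAt (fun y ↦ g (ψ.symm y)) (ψ x) :=
    (hg.continuous.continuousAt).comp (contMDiffAt_chart_symm (mem_extChartAt_target x)).continuousAt
  have hgood : ∀ᶠ y in 𝓝 (ψ x), y ∈ ψ.target ∧ g (ψ.symm y) ∈ φ.source ∧
      φ (g (ψ.symm y)) ∈ u ∧ fderiv ℝ (chartMap g x (g x) : F → E) y (Y y) =
        N (chartMap g x (g x) y) a := by
    have ht : ∀ᶠ y in 𝓝 (ψ x), y ∈ ψ.target := extChartAt_target_mem_nhds x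
    refine ht.and (.and (hψc.eventually (p := fun m ↦ m ∈ φ.source) ?_) (.and ?_ hYl))
    · beta_reduce
      rw [hx]
      exact extChartAt_source_mem_nhds _
    · have hc : ContinuousAt (fun y ↦ φ (g (ψ.symm y))) (ψ x) :=
        ContinuousAt.comp (g := φ) (by rw [hx]; exact continuousAt_extChartAt _) hψc
      refine hc.eventually ?_
      beta_reduce
      rw [hx]
      exact hfr.isOpen.mem_nhds hfr.mem
  have hαc : ContinuousAt α 0 := (hα 0 h0).continuousAt
  rw [← hα0] at hgood
  obtain ⟨δ, hδ, hball⟩ := Metric.eventually_nhds_iff_ball.1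
    ((hαc.eventually hgood).and (isOpen_Ioo.mem_nhds h0))
  have hball' : ∀ t ∈ Ioo (-δ) δ, _ := fun t ht ↦ hball t (by
    rw [Real.ball_eq_Ioo]; simpa using ht)
  have hd : ∀ t ∈ Ioo (-δ) δ, ∃ d : TangentSpace 𝓘(ℝ, ℝ) t →L[ℝ]
      TangentSpace 𝓘(ℝ, F) (ψ.symm (α t)), HasMFDerivAt 𝓘(ℝ, ℝ) 𝓘(ℝ, F) (fun t ↦ ψ.symm (α t)) t d ∧
      d (1 : ℝ) = mfderiv 𝓘(ℝ, F) 𝓘(ℝ, F) ψ.symm (α t) (Y (α t)) := fun t ht ↦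
    hasMFDerivAt_chart_symm_comp (hball' t ht).1.1 (hα t (hball' t ht).2)
  have h0' : (0 : ℝ) ∈ Ioo (-δ) δ := by simp [hδ]
  obtain ⟨d, hd0, hd1⟩ := hd 0 h0'
  -- The `h`-image of the curve is reachable point by point from its `g`-image, so its velocity at
  -- `0`, which is `Th(w)`, is in `Δ`.
  have hmain := tangent_of_forall_reachable hΔ hI (b := fun t ↦ h (ψ.symm (α t)))
    (c := fun t ↦ g (ψ.symm (α t))) hδ ?_ ?_
    ((hh.mdifferentiableAt (by simp)).hasMFDerivAt.comp 0 hd0) (fun t _ ↦ hgh _)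
  · refine mem_distribution_congr Δ ?_ ?_ hmain
    · simp only [hα0, hx]
    · refine mfderiv_apply_congr h (by simp only [hα0, hx]) (hd1.trans ?_)
      refine (mfderiv_apply_congr _ hα0 ((congrArg Y hα0).trans hY₀)).trans ?_
      exact mfderiv_chart_symm_apply (mem_extChartAt_source x) w
  · intro t ht
    obtain ⟨d, hdt, hdt1⟩ := hd t ht
    obtain ⟨⟨ht1, ht2, ht3, ht4⟩, -⟩ := hball' t ht
    have hgd : MDifferentiableAt 𝓘(ℝ, F) 𝓘(ℝ, E) g (ψ.symm (α t)) := hg.mdifferentiableAt (by simp)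
    refine ⟨_, (hgd.hasMFDerivAt.comp t hdt).hasMFDerivWithinAt, ?_⟩
    refine (hfr.mem_iff _ ht2 ht3 _).2 ?_
    have e := (fderiv_chartMap ht1 hgd ht2 (Y (α t))).symm.trans ht4
    rw [← hdt1] at e
    refine (congrArg (fun z ↦ N (φ (g (ψ.symm (α t)))) (ℓ z)) e).trans
      (Eq.trans ?_ e.symm)
    exact congrArg _ (hfr.left_inv _ ht3 a)
  · intro t ht
    obtain ⟨d, hdt, -⟩ := hd t ht
    exact (hh.continuous.continuousAt.comp hdt.continuousAt).continuousWithinAt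

end Submersions

/-! ### The dimension count for `K⁰`. -/

section LinearAlgebra

variable {E₁ E₂ E₃ : Type*} [AddCommGroup E₁] [Module ℝ E₁] [AddCommGroup E₂] [Module ℝ E₂]
  [AddCommGroup E₃] [Module ℝ E₃] [FiniteDimensional ℝ E₁] [FiniteDimensional ℝ E₂]
  [FiniteDimensional ℝ E₃]

/-- Both dimension hypotheses give `W₁` and `W₂` the same dimension `r`. The left side embeds into
`W₁ × W₂` by `(A, B)`, so its dimension is at most `2r`. The inverse image of `W₁` under `A ∘ i` has
codimension at most that of `W₁`, hence dimension at least `2r`, and by `h` its image under `i` lies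
in the left side. So the two coincide. -/
theorem comap_inf_comap_le_range {A B : E₂ →ₗ[ℝ] E₃} {i : E₁ →ₗ[ℝ] E₂}
    {W₁ W₂ : Submodule ℝ E₃} (hi : Function.Injective i)
    (hAB : LinearMap.ker A ⊓ LinearMap.ker B = ⊥)
    (hW₁ : Module.finrank ℝ E₁ = Module.finrank ℝ E₃ + Module.finrank ℝ W₁)
    (hW₂ : Module.finrank ℝ E₁ = Module.finrank ℝ E₃ + Module.finrank ℝ W₂)
    (h : ∀ w, A (i w) ∈ W₁ → B (i w) ∈ W₂) :
    W₁.comap A ⊓ W₂.comap B ≤ LinearMap.range i := by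
  set P := W₁.comap A ⊓ W₂.comap B with hP
  set R := W₁.comap (A ∘ₗ i) with hR
  have hRP : R.map i ≤ P := by
    rintro _ ⟨w, hw, rfl⟩
    exact ⟨hw, h w hw⟩
  have h1 : Module.finrank ℝ P ≤ Module.finrank ℝ (W₁ × W₂) := by
    let f : P →ₗ[ℝ] W₁ × W₂ := LinearMap.prod
      ((A ∘ₗ P.subtype).codRestrict W₁ fun p ↦ p.2.1)
      ((B ∘ₗ P.subtype).codRestrict W₂ fun p ↦ p.2.2)
    refine LinearMap.finrank_le_finrank_of_injective (f := f) ?_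
    refine (injective_iff_map_eq_zero f).2 fun p hp ↦ ?_
    have hp1 : A p = 0 := congrArg (fun z : W₁ × W₂ ↦ (z.1 : E₃)) hp
    have hp2 : B p = 0 := congrArg (fun z : W₁ × W₂ ↦ (z.2 : E₃)) hp
    have : (p : E₂) ∈ LinearMap.ker A ⊓ LinearMap.ker B := ⟨hp1, hp2⟩
    rw [hAB] at this
    exact Subtype.ext this
  have h2 : Module.finrank ℝ (E₁ ⧸ R) ≤ Module.finrank ℝ (E₃ ⧸ W₁) := by
    refine LinearMap.finrank_le_finrank_of_injective (f := R.mapQ W₁ (A ∘ₗ i) le_rfl) ?_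
    rw [← LinearMap.ker_eq_bot, Submodule.ker_mapQ, Submodule.mkQ_map_self]
  rw [Module.finrank_prod] at h1
  have h3 := Submodule.finrank_quotient_add_finrank R
  have h4 := Submodule.finrank_quotient_add_finrank W₁
  have h5 := (R.equivMapOfInjective i hi).finrank_eq
  have h6 : R.map i = P := Submodule.eq_of_le_of_finrank_le hRP (by omega)
  rw [← h6]
  exact LinearMap.map_le_range

end LinearAlgebra

/-! ### Exterior derivatives of one forms on normed spaces. -/

section Calculus

variable {F E E' E₁ : Type*} [NormedAddCommGroup F] [NormedSpace ℝ F]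
  [NormedAddCommGroup E] [NormedSpace ℝ E] [NormedAddCommGroup E'] [NormedSpace ℝ E']
  [NormedAddCommGroup E₁] [NormedSpace ℝ E₁]

/-- The pull-back of a one form on a normed space. -/
def pullbackForm (G : F → E') (θ : E' → E' →L[ℝ] ℝ) (y : F) : F →L[ℝ] ℝ :=
  (θ (G y)).comp (fderiv ℝ G y)

theorem differentiableAt_pullbackForm {G : F → E'} {θ : E' → E' →L[ℝ] ℝ} {y₀ : F}
    (hG : ContDiffAt ℝ 2 G y₀) (hθ : DifferentiableAt ℝ θ (G y₀)) :
    DifferentiableAt ℝ (pullbackForm G θ) y₀ :=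
  (hθ.comp y₀ (hG.differentiableAt (by simp))).clm_comp
    ((hG.fderiv_right (m := 1) (by norm_num)).differentiableAt (by simp))

/-- The exterior derivative commutes with pull-backs. -/
theorem fderiv_pullbackForm_sub {G : F → E'} {θ : E' → E' →L[ℝ] ℝ} {y₀ : F}
    (hG : ContDiffAt ℝ 2 G y₀) (hθ : DifferentiableAt ℝ θ (G y₀)) (a b : F) :
    fderiv ℝ (pullbackForm G θ) y₀ a b - fderiv ℝ (pullbackForm G θ) y₀ b a =
      fderiv ℝ θ (G y₀) (fderiv ℝ G y₀ a) (fderiv ℝ G y₀ b) -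
        fderiv ℝ θ (G y₀) (fderiv ℝ G y₀ b) (fderiv ℝ G y₀ a) := by
  have hG1 : DifferentiableAt ℝ G y₀ := hG.differentiableAt (by simp)
  have hG2 : DifferentiableAt ℝ (fderiv ℝ G) y₀ :=
    (hG.fderiv_right (m := 1) (by norm_num)).differentiableAt (by simp)
  have hs : fderiv ℝ (fderiv ℝ G) y₀ a b = fderiv ℝ (fderiv ℝ G) y₀ b a :=
    (hG.isSymmSndFDerivAt (by simp)) a b
  have h : ∀ a b, fderiv ℝ (pullbackForm G θ) y₀ a b =
      θ (G y₀) (fderiv ℝ (fderiv ℝ G) y₀ a b) +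
        fderiv ℝ θ (G y₀) (fderiv ℝ G y₀ a) (fderiv ℝ G y₀ b) := by
    intro a b
    have h1 : HasFDerivAt (pullbackForm G θ) _ y₀ :=
      (hθ.hasFDerivAt.comp y₀ hG1.hasFDerivAt).clm_comp hG2.hasFDerivAt
    rw [h1.fderiv]
    simp
  rw [h, h, hs]
  ring

/-- A one form that vanishes on the inverse image, under `f`, of a distribution with commuting frame
has exterior derivative zero there. -/
theorem fderiv_symm_of_vanishing {f : F → E} {β : F → F →L[ℝ] ℝ} {y₀ : F}
    {N : E → E₁ →L[ℝ] E} {ℓ : E →L[ℝ] E₁} {u : Set E} (hf : ContDiffAt ℝ 2 f y₀)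
    (hβ : DifferentiableAt ℝ β y₀) (hu : u ∈ 𝓝 (f y₀)) (hN : DifferentiableAt ℝ N (f y₀))
    (hl : ∀ z ∈ u, ∀ a, ℓ (N z a) = a)
    (hcomm : ∀ a b, fderiv ℝ N (f y₀) (N (f y₀) a) b = fderiv ℝ N (f y₀) (N (f y₀) b) a)
    (hv : ∀ᶠ y in 𝓝 y₀, ∀ k, N (f y) (ℓ (fderiv ℝ f y k)) = fderiv ℝ f y k → β y k = 0)
    {Y Z : F → F} {a b : E₁} (hY : DifferentiableAt ℝ Y y₀) (hZ : DifferentiableAt ℝ Z y₀)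
    (hYl : ∀ᶠ y in 𝓝 y₀, fderiv ℝ f y (Y y) = N (f y) a)
    (hZl : ∀ᶠ y in 𝓝 y₀, fderiv ℝ f y (Z y) = N (f y) b) :
    fderiv ℝ β y₀ (Y y₀) (Z y₀) = fderiv ℝ β y₀ (Z y₀) (Y y₀) := by
  have hf1 : DifferentiableAt ℝ f y₀ := hf.differentiableAt (by simp)
  have hf2 : DifferentiableAt ℝ (fderiv ℝ f) y₀ :=
    (hf.fderiv_right (m := 1) (by norm_num)).differentiableAt (by simp)
  have hu' : ∀ᶠ y in 𝓝 y₀, f y ∈ u := hf1.continuousAt.eventually hu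
  -- Differentiate `β(Z) = 0`, which holds near `y₀` because `Z` projects into the distribution.
  have h1 : ∀ {Z : F → F} {b : E₁}, DifferentiableAt ℝ Z y₀ →
      (∀ᶠ y in 𝓝 y₀, fderiv ℝ f y (Z y) = N (f y) b) → ∀ w,
      fderiv ℝ β y₀ w (Z y₀) = - β y₀ (fderiv ℝ Z y₀ w) := by
    intro Z b hZ hZl w
    have h2 : HasFDerivAt (fun y ↦ β y (Z y)) (0 : F →L[ℝ] ℝ) y₀ := by
      refine (hasFDerivAt_const (0 : ℝ) y₀).congr_of_eventuallyEq ?_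
      filter_upwards [hZl, hv, hu'] with y h3 h4 h5
      exact h4 _ (by rw [h3, hl _ h5])
    have h3 := DFunLike.congr_fun ((hβ.hasFDerivAt.clm_apply hZ.hasFDerivAt).unique h2) w
    simp at h3
    linarith
  -- Differentiate the lifting relation `Df(Z) = N(f)b`.
  have h2 : ∀ {Z : F → F} {b : E₁}, DifferentiableAt ℝ Z y₀ →
      (∀ᶠ y in 𝓝 y₀, fderiv ℝ f y (Z y) = N (f y) b) → ∀ w,
      fderiv ℝ f y₀ (fderiv ℝ Z y₀ w) + fderiv ℝ (fderiv ℝ f) y₀ w (Z y₀) =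
        fderiv ℝ N (f y₀) (fderiv ℝ f y₀ w) b := by
    intro Z b hZ hZl w
    have h3 := (hf2.hasFDerivAt.clm_apply hZ.hasFDerivAt).congr_of_eventuallyEq
      (f₁ := fun y ↦ N (f y) b) (hZl.mono fun _ h ↦ h.symm)
    have h4 := (hN.hasFDerivAt.comp y₀ hf1.hasFDerivAt).clm_apply (hasFDerivAt_const b y₀)
    simpa using DFunLike.congr_fun (h3.unique h4) w
  have h3 := h2 hY hYl (Z y₀)
  have h4 := h2 hZ hZl (Y y₀)
  rw [hZl.self_of_nhds] at h3
  rw [hYl.self_of_nhds, hcomm, ← h3, (hf.isSymmSndFDerivAt (by simp)) (Y y₀) (Z y₀),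
    add_left_inj] at h4
  -- Since the frame commutes and the second derivative of `f` is symmetric, `[Y, Z]` is vertical.
  -- So `β` kills it, and `dβ(Y, Z) = -β([Y, Z]) = 0`.
  have h5 : fderiv ℝ f y₀ (fderiv ℝ Z y₀ (Y y₀) - fderiv ℝ Y y₀ (Z y₀)) = 0 := by
    rw [map_sub, h4, sub_self]
  have h6 := hv.self_of_nhds _ (by rw [h5]; simp)
  rw [map_sub, sub_eq_zero] at h6
  rw [h1 hZ hZl, h1 hY hYl, h6]

end Calculus

/-! ### Smooth one forms in charts. -/

section OneForms

variable {E : Type*} [NormedAddCommGroup E] [NormedSpace ℝ E]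
  {M : Type*} [TopologicalSpace M] [ChartedSpace E M] [IsManifold 𝓘(ℝ, E) ∞ M]

/-- The trivialization of the cotangent bundle at `m₀` is composition with the derivative of the
inverse chart, so it turns the section into the local representative. -/
theorem IsSmoothOneForm.contDiffAt_oneFormInChart
    {θ : ∀ m : M, TangentSpace 𝓘(ℝ, E) m →L[ℝ] ℝ} (hθ : IsSmoothOneForm θ) (m₀ : M) :
    ContDiffAt ℝ ∞ (oneFormInChart θ m₀) (extChartAt 𝓘(ℝ, E) m₀ m₀) := by
  have h := ((contMDiffAt_hom_bundle (E₂ := Bundle.Trivial M ℝ) _).1 (hθ m₀)).2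
  have hm : (extChartAt 𝓘(ℝ, E) m₀).symm (extChartAt 𝓘(ℝ, E) m₀ m₀) = m₀ := extChartAt_to_inv m₀
  have h' := h.comp_of_eq (contMDiffAt_chart_symm (mem_extChartAt_target m₀)) hm
  refine (contMDiffAt_iff_contDiffAt.1 h').congr_of_eventuallyEq ?_
  filter_upwards [extChartAt_target_mem_nhds (I := 𝓘(ℝ, E)) m₀] with y hy
  have hys : (extChartAt 𝓘(ℝ, E) m₀).symm y ∈ (chartAt E m₀).source := by
    rw [← extChartAt_source 𝓘(ℝ, E)]
    exact (extChartAt 𝓘(ℝ, E) m₀).map_target hy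
  have h1 := TangentBundle.symmL_trivializationAt (I := 𝓘(ℝ, E)) hys
  rw [(extChartAt 𝓘(ℝ, E) m₀).right_inv hy, show Set.range 𝓘(ℝ, E) = Set.univ by simp,
    mfderivWithin_univ] at h1
  ext k
  have h2 := DFunLike.congr_fun h1 k
  refine (congrArg (θ ((extChartAt 𝓘(ℝ, E) m₀).symm y)) h2).symm.trans ?_
  have h3 : (trivializationAt ℝ (Bundle.Trivial M ℝ) m₀).continuousLinearMapAt ℝ
      ((extChartAt 𝓘(ℝ, E) m₀).symm y) = ContinuousLinearMap.id ℝ ℝ :=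
    Bundle.Trivial.continuousLinearMapAt_trivialization ..
  exact (DFunLike.congr_fun h3 _).symm

end OneForms

/-! ### The splitting of `TV` and the one forms `θ⁺`, `θ⁻`. -/

section Parts

variable {EQ : Type*} [NormedAddCommGroup EQ] [NormedSpace ℝ EQ] [FiniteDimensional ℝ EQ]
  {Q : Type*} [TopologicalSpace Q] [ChartedSpace EQ Q] [IsManifold 𝓘(ℝ, EQ) ∞ Q]
  {EV : Type*} [NormedAddCommGroup EV] [NormedSpace ℝ EV] [FiniteDimensional ℝ EV]
  {V : Type*} [TopologicalSpace V] [ChartedSpace EV V] [IsManifold 𝓘(ℝ, EV) ∞ V]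
  {ED : Type*} [NormedAddCommGroup ED] [NormedSpace ℝ ED]
  {D : Type*} [TopologicalSpace D] [ChartedSpace ED D] [IsManifold 𝓘(ℝ, ED) ∞ D]

namespace DiscreteTangentBundle

theorem tMinus_plusPart (B : DiscreteTangentBundle EQ Q EV V) (v : V)
    (a : TangentSpace 𝓘(ℝ, EV) v) : B.tMinus v (B.plusPart v a) = 0 :=
  Submodule.projection_apply_mem (B.isCompl_ker v) a

theorem tPlus_minusPart (B : DiscreteTangentBundle EQ Q EV V) (v : V)
    (a : TangentSpace 𝓘(ℝ, EV) v) : B.tPlus v (B.minusPart v a) = 0 :=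
  Submodule.projection_apply_mem (B.isCompl_ker v).symm a

theorem plusPart_add_minusPart (B : DiscreteTangentBundle EQ Q EV V) (v : V)
    (a : TangentSpace 𝓘(ℝ, EV) v) : B.plusPart v a + B.minusPart v a = a :=
  Submodule.projection_add_projection_eq_self (B.isCompl_ker v) a

theorem tPlus_plusPart (B : DiscreteTangentBundle EQ Q EV V) (v : V)
    (a : TangentSpace 𝓘(ℝ, EV) v) : B.tPlus v (B.plusPart v a) = B.tPlus v a := by
  have h := congrArg (B.tPlus v) (B.plusPart_add_minusPart v a)
  rwa [map_add, tPlus_minusPart, add_zero] at h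

theorem tMinus_minusPart (B : DiscreteTangentBundle EQ Q EV V) (v : V)
    (a : TangentSpace 𝓘(ℝ, EV) v) : B.tMinus v (B.minusPart v a) = B.tMinus v a := by
  have h := congrArg (B.tMinus v) (B.plusPart_add_minusPart v a)
  rwa [map_add, tMinus_plusPart, zero_add] at h

theorem eq_of_tPlus_eq_of_tMinus_eq (B : DiscreteTangentBundle EQ Q EV V) (v : V)
    {a b : TangentSpace 𝓘(ℝ, EV) v} (h₁ : B.tPlus v a = B.tPlus v b)
    (h₂ : B.tMinus v a = B.tMinus v b) : a = b := by
  have h : a - b ∈ (B.tPlus v).ker ⊓ (B.tMinus v).ker :=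
    ⟨LinearMap.sub_mem_ker_iff.2 h₁, LinearMap.sub_mem_ker_iff.2 h₂⟩
  rw [B.ker_inf_ker v] at h
  exact sub_eq_zero.1 h

theorem eq_plusPart (B : DiscreteTangentBundle EQ Q EV V) (v : V)
    {a b : TangentSpace 𝓘(ℝ, EV) v} (h₁ : B.tPlus v a = B.tPlus v b) (h₂ : B.tMinus v a = 0) :
    a = B.plusPart v b :=
  B.eq_of_tPlus_eq_of_tMinus_eq v (h₁.trans (B.tPlus_plusPart v b).symm)
    (h₂.trans (B.tMinus_plusPart v b).symm)

end DiscreteTangentBundle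

namespace DCLS

theorem thetaPlus_apply (S : DCLS EQ Q EV V ED D) (v : V) (a : TangentSpace 𝓘(ℝ, EV) v) :
    S.thetaPlus v a = S.sigma v (S.plusPart v a) := rfl

theorem thetaMinus_apply (S : DCLS EQ Q EV V ED D) (v : V) (a : TangentSpace 𝓘(ℝ, EV) v) :
    S.thetaMinus v a = -S.sigma v (S.minusPart v a) := rfl

theorem thetaMinus_eq (S : DCLS EQ Q EV V ED D) (v : V) :
    S.thetaMinus v = S.thetaPlus v - S.sigma v := by
  ext a
  have h := congrArg (S.sigma v) (S.plusPart_add_minusPart v a)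
  rw [map_add] at h
  change S.thetaMinus v a = S.thetaPlus v a - S.sigma v a
  rw [thetaPlus_apply, thetaMinus_apply, ← h]
  ring

theorem oneFormInChart_thetaMinus (S : DCLS EQ Q EV V ED D) (v : V) :
    oneFormInChart S.thetaMinus v =
      oneFormInChart S.thetaPlus v - oneFormInChart S.sigma v := by
  ext y a
  simp only [oneFormInChart, thetaMinus_eq]
  rfl

/-- The splitting is defined pointwise, so its regularity needs a formula. In charts `A = (T∂⁻,
T∂⁺)` is an isomorphism, by the trivial intersection of the kernels and the dimensions, and `δv⁺ =
A⁻¹(0, T∂⁺ δv)` depends smoothly on the point. -/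
theorem differentiableAt_thetaPlus (S : DCLS EQ Q EV V ED D) (v : V) :
    DifferentiableAt ℝ (oneFormInChart S.thetaPlus v) (extChartAt 𝓘(ℝ, EV) v v) := by
  have : CompleteSpace EV := FiniteDimensional.complete ℝ EV
  set y₀ := extChartAt 𝓘(ℝ, EV) v v with hy₀
  have hv : (extChartAt 𝓘(ℝ, EV) v).symm y₀ = v := extChartAt_to_inv v
  have hyt : y₀ ∈ (extChartAt 𝓘(ℝ, EV) v).target := mem_extChartAt_target v
  let fP : EV → EQ := chartMap S.bdPlus v (S.bdPlus v)
  let fM : EV → EQ := chartMap S.bdMinus v (S.bdMinus v)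
  have hsP : S.bdPlus ((extChartAt 𝓘(ℝ, EV) v).symm y₀) ∈
      (extChartAt 𝓘(ℝ, EQ) (S.bdPlus v)).source := by
    rw [hv]; exact mem_extChartAt_source _
  have hsM : S.bdMinus ((extChartAt 𝓘(ℝ, EV) v).symm y₀) ∈
      (extChartAt 𝓘(ℝ, EQ) (S.bdMinus v)).source := by
    rw [hv]; exact mem_extChartAt_source _
  have hP : ContDiffAt ℝ ∞ (fderiv ℝ fP) y₀ :=
    (contDiffAt_chartMap hyt S.contMDiff_bdPlus.contMDiffAt hsP).fderiv_right (by simp)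
  have hM : ContDiffAt ℝ ∞ (fderiv ℝ fM) y₀ :=
    (contDiffAt_chartMap hyt S.contMDiff_bdMinus.contMDiffAt hsM).fderiv_right (by simp)
  have hsymm := contMDiffAt_chart_symm (E := EV) hyt
  have hev : ∀ᶠ y in 𝓝 y₀, y ∈ (extChartAt 𝓘(ℝ, EV) v).target ∧
      S.bdPlus ((extChartAt 𝓘(ℝ, EV) v).symm y) ∈ (extChartAt 𝓘(ℝ, EQ) (S.bdPlus v)).source ∧
      S.bdMinus ((extChartAt 𝓘(ℝ, EV) v).symm y) ∈
        (extChartAt 𝓘(ℝ, EQ) (S.bdMinus v)).source := by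
    have h1 : ∀ᶠ y in 𝓝 y₀, y ∈ (extChartAt 𝓘(ℝ, EV) v).target :=
      extChartAt_target_mem_nhds v
    refine h1.and (.and ?_ ?_)
    · exact (S.contMDiff_bdPlus.continuous.continuousAt.comp hsymm.continuousAt).eventually
        ((isOpen_extChartAt_source _).mem_nhds hsP)
    · exact (S.contMDiff_bdMinus.continuous.continuousAt.comp hsymm.continuousAt).eventually
        ((isOpen_extChartAt_source _).mem_nhds hsM)
  let T : ∀ y, EV →L[ℝ] EV := fun y ↦
    mfderiv 𝓘(ℝ, EV) 𝓘(ℝ, EV) (extChartAt 𝓘(ℝ, EV) v).symm y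
  have hTP : ∀ y ∈ (extChartAt 𝓘(ℝ, EV) v).target,
      S.bdPlus ((extChartAt 𝓘(ℝ, EV) v).symm y) ∈ (extChartAt 𝓘(ℝ, EQ) (S.bdPlus v)).source →
      ∀ j k, fderiv ℝ fP y j = fderiv ℝ fP y k →
        (S.tPlus ((extChartAt 𝓘(ℝ, EV) v).symm y) (T y j) : EQ) =
          S.tPlus ((extChartAt 𝓘(ℝ, EV) v).symm y) (T y k) := by
    intro y hy hs j k hjk
    have hd : MDifferentiableAt 𝓘(ℝ, EV) 𝓘(ℝ, EQ) S.bdPlus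
      ((extChartAt 𝓘(ℝ, EV) v).symm y) := S.contMDiff_bdPlus.mdifferentiableAt (by simp)
    exact mfderiv_chart_injective hs
      ((fderiv_chartMap hy hd hs j).symm.trans (hjk.trans (fderiv_chartMap hy hd hs k)))
  have hTM : ∀ y ∈ (extChartAt 𝓘(ℝ, EV) v).target,
      S.bdMinus ((extChartAt 𝓘(ℝ, EV) v).symm y) ∈ (extChartAt 𝓘(ℝ, EQ) (S.bdMinus v)).source →
      ∀ j k, fderiv ℝ fM y j = fderiv ℝ fM y k →
        (S.tMinus ((extChartAt 𝓘(ℝ, EV) v).symm y) (T y j) : EQ) =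
          S.tMinus ((extChartAt 𝓘(ℝ, EV) v).symm y) (T y k) := by
    intro y hy hs j k hjk
    have hd : MDifferentiableAt 𝓘(ℝ, EV) 𝓘(ℝ, EQ) S.bdMinus
      ((extChartAt 𝓘(ℝ, EV) v).symm y) := S.contMDiff_bdMinus.mdifferentiableAt (by simp)
    exact mfderiv_chart_injective hs
      ((fderiv_chartMap hy hd hs j).symm.trans (hjk.trans (fderiv_chartMap hy hd hs k)))
  have hTi : Function.Injective (T y₀) :=
    (isInvertible_mfderiv_chart_symm (E := EV) hyt).injective
  let A : EV → EV →L[ℝ] EQ × EQ := fun y ↦ (fderiv ℝ fM y).prod (fderiv ℝ fP y)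
  have hAi : Function.Injective (A y₀) := by
    intro j k hjk
    have h1 : fderiv ℝ fM y₀ j = fderiv ℝ fM y₀ k := congrArg Prod.fst hjk
    have h2 : fderiv ℝ fP y₀ j = fderiv ℝ fP y₀ k := congrArg Prod.snd hjk
    exact hTi (S.eq_of_tPlus_eq_of_tMinus_eq _ (hTP y₀ hyt hsP j k h2) (hTM y₀ hyt hsM j k h1))
  let e : EV ≃L[ℝ] EQ × EQ := (LinearEquiv.ofInjectiveOfFinrankEq (A y₀).toLinearMap hAi (by
    rw [Module.finrank_prod, S.finrank_eq, two_mul])).toContinuousLinearEquiv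
  have he : (e : EV →L[ℝ] EQ × EQ) = A y₀ := rfl
  have hA : ContDiffAt ℝ ∞ A y₀ := by
    have h := (contDiffAt_const (c := ContinuousLinearMap.inl ℝ EQ EQ)).clm_comp hM |>.add
      ((contDiffAt_const (c := ContinuousLinearMap.inr ℝ EQ EQ)).clm_comp hP)
    refine h.congr_of_eventuallyEq (.of_forall fun y ↦ ?_)
    ext k <;> simp [A]
  have hinv : ContDiffAt ℝ ∞ (fun y ↦ (A y).inverse) y₀ := by
    have h := contDiffAt_map_inverse (n := ∞) e
    rw [he] at h
    exact h.comp y₀ hA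
  have hun : ∀ᶠ y in 𝓝 y₀, (A y).IsInvertible :=
    hA.continuousAt.eventually (he ▸ e.nhds)
  have hσ := S.smooth_sigma.contDiffAt_oneFormInChart v
  have hG : ContDiffAt ℝ ∞ (fun y ↦ (oneFormInChart S.sigma v y).comp
      (((A y).inverse).comp ((ContinuousLinearMap.inr ℝ EQ EQ).comp (fderiv ℝ fP y)))) y₀ :=
    hσ.clm_comp (hinv.clm_comp (contDiffAt_const.clm_comp hP))
  refine (hG.differentiableAt (by simp)).congr_of_eventuallyEq ?_
  filter_upwards [hev, hun] with y ⟨h1, h2, h3⟩ hi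
  ext k
  -- The vector `j` has the two boundary components that characterize the plus part of `k`, so it
  -- represents this plus part.
  set j : EV := (A y).inverse (0, fderiv ℝ fP y k) with hj
  have hAj : A y j = (0, fderiv ℝ fP y k) := hi.inverse_apply_eq.1 rfl |>.symm
  have hj1 := hTP y h1 h2 j k (congrArg Prod.snd hAj)
  have hj2 := hTM y h1 h3 j 0 ((congrArg Prod.fst hAj).trans (map_zero _).symm)
  rw [map_zero] at hj2
  have hj3 := S.eq_plusPart ((extChartAt 𝓘(ℝ, EV) v).symm y) hj1 (hj2.trans (map_zero _))
  exact (congrArg (S.sigma ((extChartAt 𝓘(ℝ, EV) v).symm y)) hj3).symm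

theorem differentiableAt_thetaMinus (S : DCLS EQ Q EV V ED D) (v : V) :
    DifferentiableAt ℝ (oneFormInChart S.thetaMinus v) (extChartAt 𝓘(ℝ, EV) v v) := by
  rw [oneFormInChart_thetaMinus]
  exact (S.differentiableAt_thetaPlus v).sub
    ((S.smooth_sigma.contDiffAt_oneFormInChart v).differentiableAt (by simp))

/-- From `θ⁻ = θ⁺ - σ`: the exterior derivatives of `θ⁺` and `θ⁻` differ by `dσ = 0`.
Differentiability of `θ⁺` is needed for the derivative of the difference to split. -/
theorem omegaPlus_eq_omegaMinus (S : DCLS EQ Q EV V ED D)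
    (hσ : ∀ v δv δw, dOneForm S.sigma v δv δw = 0) (v : V) (a b : TangentSpace 𝓘(ℝ, EV) v) :
    S.omegaPlus v a b = S.omegaMinus v a b := by
  have h := hσ v a b
  have key : ∀ a b : EV, fderiv ℝ (oneFormInChart S.thetaMinus v) (extChartAt 𝓘(ℝ, EV) v v) a b =
      fderiv ℝ (oneFormInChart S.thetaPlus v) (extChartAt 𝓘(ℝ, EV) v v) a b -
        fderiv ℝ (oneFormInChart S.sigma v) (extChartAt 𝓘(ℝ, EV) v v) a b := by
    intro a b
    rw [oneFormInChart_thetaMinus, fderiv_sub (S.differentiableAt_thetaPlus v)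
      ((S.smooth_sigma.contDiffAt_oneFormInChart v).differentiableAt (by simp))]
    rfl
  let a' : EV := mfderiv 𝓘(ℝ, EV) 𝓘(ℝ, EV) (extChartAt 𝓘(ℝ, EV) v) v a
  let b' : EV := mfderiv 𝓘(ℝ, EV) 𝓘(ℝ, EV) (extChartAt 𝓘(ℝ, EV) v) v b
  have h1 := key a' b'
  have h2 := key b' a'
  change _ - _ = _ at h
  change -(_ - _) = -(_ - _)
  linarith

end DCLS

end Parts

/-! ### Pull-backs of one forms between manifolds. -/

section PullBack

variable {E : Type*} [NormedAddCommGroup E] [NormedSpace ℝ E]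
  {M : Type*} [TopologicalSpace M] [ChartedSpace E M] [IsManifold 𝓘(ℝ, E) ∞ M]
  {F : Type*} [NormedAddCommGroup F] [NormedSpace ℝ F]
  {D : Type*} [TopologicalSpace D] [ChartedSpace F D] [IsManifold 𝓘(ℝ, F) ∞ D]

/-- The local representative of the pull-back of the one form `θ` by `g`. -/
def pullbackInChart (θ : ∀ m : M, TangentSpace 𝓘(ℝ, E) m →L[ℝ] ℝ) (g : D → M) (x : D) :
    F → F →L[ℝ] ℝ :=
  pullbackForm (chartMap g x (g x) : F → E) (oneFormInChart θ (g x))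

theorem eventually_chartMap {g : D → M} {x : D} {s : Set D} (hs : s ∈ 𝓝 x)
    (hg : ContinuousAt g x) : ∀ᶠ y in 𝓝 (extChartAt 𝓘(ℝ, F) x x),
      y ∈ (extChartAt 𝓘(ℝ, F) x).target ∧ (extChartAt 𝓘(ℝ, F) x).symm y ∈ s ∧
      g ((extChartAt 𝓘(ℝ, F) x).symm y) ∈ (extChartAt 𝓘(ℝ, E) (g x)).source := by
  have hx : (extChartAt 𝓘(ℝ, F) x).symm (extChartAt 𝓘(ℝ, F) x x) = x := extChartAt_to_inv x
  have hc : ContinuousAt (extChartAt 𝓘(ℝ, F) x).symm (extChartAt 𝓘(ℝ, F) x x) :=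
    (contMDiffAt_chart_symm (mem_extChartAt_target x)).continuousAt
  have h1 : ∀ᶠ y in 𝓝 (extChartAt 𝓘(ℝ, F) x x), y ∈ (extChartAt 𝓘(ℝ, F) x).target :=
    extChartAt_target_mem_nhds x
  have h2 : ∀ᶠ z in 𝓝 x, z ∈ s ∧ g z ∈ (extChartAt 𝓘(ℝ, E) (g x)).source :=
    Filter.Eventually.and hs (hg.eventually (extChartAt_source_mem_nhds (g x)))
  refine h1.and (hc.eventually (p := fun z ↦ z ∈ s ∧
    g z ∈ (extChartAt 𝓘(ℝ, E) (g x)).source) ?_)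
  rwa [hx]

/-- The chart at `g x` cancels, which frees pointwise identities between one forms from the charts
on the target. -/
theorem pullbackInChart_apply (θ : ∀ m : M, TangentSpace 𝓘(ℝ, E) m →L[ℝ] ℝ) {g : D → M} {x : D}
    {y : F} (hy : y ∈ (extChartAt 𝓘(ℝ, F) x).target)
    (hg : MDifferentiableAt 𝓘(ℝ, F) 𝓘(ℝ, E) g ((extChartAt 𝓘(ℝ, F) x).symm y))
    (hs : g ((extChartAt 𝓘(ℝ, F) x).symm y) ∈ (extChartAt 𝓘(ℝ, E) (g x)).source) (k : F) :
    pullbackInChart θ g x y k = θ (g ((extChartAt 𝓘(ℝ, F) x).symm y))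
      (mfderiv 𝓘(ℝ, F) 𝓘(ℝ, E) g ((extChartAt 𝓘(ℝ, F) x).symm y)
        (mfderiv 𝓘(ℝ, F) 𝓘(ℝ, F) (extChartAt 𝓘(ℝ, F) x).symm y k)) := by
  have key : ∀ {m m' : M} {v v' : E}, m = m' → v = v' →
      (θ m : E →L[ℝ] ℝ) v = (θ m' : E →L[ℝ] ℝ) v' := by
    rintro m _ v _ rfl rfl
    rfl
  refine key ((extChartAt 𝓘(ℝ, E) (g x)).left_inv hs) ?_
  refine (congrArg (mfderiv 𝓘(ℝ, E) 𝓘(ℝ, E) (extChartAt 𝓘(ℝ, E) (g x)).symm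
    (extChartAt 𝓘(ℝ, E) (g x) (g ((extChartAt 𝓘(ℝ, F) x).symm y))))
    (fderiv_chartMap hy hg hs k)).trans ?_
  exact mfderiv_chart_symm_apply hs _

theorem differentiableAt_pullbackInChart {θ : ∀ m : M, TangentSpace 𝓘(ℝ, E) m →L[ℝ] ℝ}
    {g : D → M} {x : D} (hg : ContMDiffAt 𝓘(ℝ, F) 𝓘(ℝ, E) ∞ g x)
    (hθ : DifferentiableAt ℝ (oneFormInChart θ (g x)) (extChartAt 𝓘(ℝ, E) (g x) (g x))) :
    DifferentiableAt ℝ (pullbackInChart θ g x) (extChartAt 𝓘(ℝ, F) x x) :=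
  differentiableAt_pullbackForm ((contDiffAt_chartMap_self hg).of_le ENat.LEInfty.out)
    (by rwa [chartMap_self])

/-- The exterior derivative of the pull-back of a one form. -/
theorem dOneForm_mfderiv {θ : ∀ m : M, TangentSpace 𝓘(ℝ, E) m →L[ℝ] ℝ}
    {g : D → M} {x : D} (hg : ContMDiffAt 𝓘(ℝ, F) 𝓘(ℝ, E) ∞ g x)
    (hθ : DifferentiableAt ℝ (oneFormInChart θ (g x)) (extChartAt 𝓘(ℝ, E) (g x) (g x)))
    (a b : TangentSpace 𝓘(ℝ, F) x) {a' b' : F}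
    (ha : mfderiv 𝓘(ℝ, F) 𝓘(ℝ, F) (extChartAt 𝓘(ℝ, F) x) x a = a')
    (hb : mfderiv 𝓘(ℝ, F) 𝓘(ℝ, F) (extChartAt 𝓘(ℝ, F) x) x b = b') :
    dOneForm θ (g x) (mfderiv 𝓘(ℝ, F) 𝓘(ℝ, E) g x a) (mfderiv 𝓘(ℝ, F) 𝓘(ℝ, E) g x b) =
      fderiv ℝ (pullbackInChart θ g x) (extChartAt 𝓘(ℝ, F) x x) a' b' -
        fderiv ℝ (pullbackInChart θ g x) (extChartAt 𝓘(ℝ, F) x x) b' a' := by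
  have hd : MDifferentiableAt 𝓘(ℝ, F) 𝓘(ℝ, E) g x := hg.mdifferentiableAt (by simp)
  have h := fderiv_pullbackForm_sub ((contDiffAt_chartMap_self hg).of_le ENat.LEInfty.out)
    (θ := oneFormInChart θ (g x)) (by rwa [chartMap_self]) a' b'
  refine Eq.trans ?_ h.symm
  rw [chartMap_self]
  have h1 := fderiv_chartMap_self hd a
  have h2 := fderiv_chartMap_self hd b
  rw [ha] at h1
  rw [hb] at h2
  let D : E →L[ℝ] E →L[ℝ] ℝ :=
    fderiv ℝ (oneFormInChart θ (g x)) (extChartAt 𝓘(ℝ, E) (g x) (g x))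
  exact (congrArg₂ (fun p q : E ↦ D p q - D q p) h1 h2).symm

end PullBack

/-! ### Holonomic systems and their evolution maps. -/

section Systems

variable {EQ : Type*} [NormedAddCommGroup EQ] [NormedSpace ℝ EQ] [FiniteDimensional ℝ EQ]
  {Q : Type*} [TopologicalSpace Q] [ChartedSpace EQ Q] [IsManifold 𝓘(ℝ, EQ) ∞ Q]
  {EV : Type*} [NormedAddCommGroup EV] [NormedSpace ℝ EV] [FiniteDimensional ℝ EV]
  {V : Type*} [TopologicalSpace V] [ChartedSpace EV V] [IsManifold 𝓘(ℝ, EV) ∞ V]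
  {ED : Type*} [NormedAddCommGroup ED] [NormedSpace ℝ ED]
  {D : Type*} [TopologicalSpace D] [ChartedSpace ED D] [IsManifold 𝓘(ℝ, ED) ∞ D]
  {Δ : ∀ q : Q, Submodule ℝ (TangentSpace 𝓘(ℝ, EQ) q)}

namespace DCLS

theorem mfderiv_bdPlus_incl (S : DCLS EQ Q EV V ED D) (x : D) (w : TangentSpace 𝓘(ℝ, ED) x) :
    mfderiv 𝓘(ℝ, ED) 𝓘(ℝ, EQ) (S.bdPlus ∘ S.incl) x w = S.tPlus (S.incl x) (S.tIncl x w) := by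
  rw [mfderiv_comp x (S.contMDiff_bdPlus.mdifferentiableAt (by simp))
    (S.contMDiff_incl.mdifferentiableAt (by simp))]
  rfl

theorem mfderiv_bdMinus_incl (S : DCLS EQ Q EV V ED D) (x : D) (w : TangentSpace 𝓘(ℝ, ED) x) :
    mfderiv 𝓘(ℝ, ED) 𝓘(ℝ, EQ) (S.bdMinus ∘ S.incl) x w = S.tMinus (S.incl x) (S.tIncl x w) := by
  rw [mfderiv_comp x (S.contMDiff_bdMinus.mdifferentiableAt (by simp))
    (S.contMDiff_incl.mdifferentiableAt (by simp))]
  rfl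

/-- Along the constraint submanifold of a holonomic system, `∂⁻` and `∂⁺` are in the same leaf. -/
theorem IsHolonomic.tPlus_mem [FiniteDimensional ℝ ED] [SecondCountableTopology Q]
    {S : DCLS EQ Q EV V ED D} (hS : S.IsHolonomic Δ) {x : D} {w : TangentSpace 𝓘(ℝ, ED) x}
    (hw : S.tMinus (S.incl x) (S.tIncl x w) ∈ Δ (S.bdMinus (S.incl x))) :
    S.tPlus (S.incl x) (S.tIncl x w) ∈ Δ (S.bdPlus (S.incl x)) := by
  have h := mfderiv_mem_of_reachable hS.isDistribution hS.isInvolutive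
    (S.contMDiff_bdMinus.comp S.contMDiff_incl) (S.contMDiff_bdPlus.comp S.contMDiff_incl)
    hS.reachable (S.surjective_bdMinus_incl x) (w := w) (by rwa [mfderiv_bdMinus_incl])
  rwa [mfderiv_bdPlus_incl] at h

/-- `K⁰` is tangent to the constraint submanifold. -/
theorem IsHolonomic.K0_le [FiniteDimensional ℝ ED] [SecondCountableTopology Q]
    {S : DCLS EQ Q EV V ED D} (hS : S.IsHolonomic Δ) (x : D) :
    S.K0 Δ x ≤ (S.tIncl x).range := by
  let A : EV →L[ℝ] EQ := S.tMinus (S.incl x)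
  let B : EV →L[ℝ] EQ := S.tPlus (S.incl x)
  let i : ED →L[ℝ] EV := S.tIncl x
  exact comap_inf_comap_le_range (A := A.toLinearMap) (B := B.toLinearMap) (i := i.toLinearMap)
    (W₁ := Δ (S.bdMinus (S.incl x))) (W₂ := Δ (S.bdPlus (S.incl x))) (S.injective_incl x)
    ((inf_comm _ _).trans (S.ker_inf_ker (S.incl x))) (hS.finrank_eq _) (hS.finrank_eq _)
    fun w hw ↦ hS.tPlus_mem (x := x) (w := w) hw

section Evolution

variable {S : DCLS EQ Q EV V ED D} {F : D → D} {U U' : Set D}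

theorem IsEvolutionMap.contMDiffAt (hF : S.IsEvolutionMap F U U') {x : D} (hx : x ∈ U) :
    ContMDiffAt 𝓘(ℝ, ED) 𝓘(ℝ, ED) ∞ F x :=
  hF.contMDiffOn.contMDiffAt (hF.isOpen_dom.mem_nhds hx)

theorem IsEvolutionMap.bdMinus_eq (hF : S.IsEvolutionMap F U U') {x : D} (hx : x ∈ U) :
    S.bdMinus (S.incl (F x)) = S.bdPlus (S.incl x) :=
  (hF.isSolutionPair x hx).1.symm

/-- Derivative of `∂⁻ ∘ F = ∂⁺`, an identity on the open set `U`. -/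
theorem IsEvolutionMap.tMinus_eq (hF : S.IsEvolutionMap F U U') {x : D} (hx : x ∈ U)
    (w : TangentSpace 𝓘(ℝ, ED) x) :
    (S.tMinus (S.incl (F x)) (S.tIncl (F x) (mfderiv 𝓘(ℝ, ED) 𝓘(ℝ, ED) F x w)) : EQ) =
      S.tPlus (S.incl x) (S.tIncl x w) := by
  have hd : MDifferentiableAt 𝓘(ℝ, ED) 𝓘(ℝ, ED) F x :=
    (hF.contMDiffAt hx).mdifferentiableAt (by simp)
  have hg : MDifferentiableAt 𝓘(ℝ, ED) 𝓘(ℝ, EQ) (S.bdMinus ∘ S.incl) (F x) :=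
    (S.contMDiff_bdMinus.comp S.contMDiff_incl).mdifferentiableAt (by simp)
  have h1 : ((S.bdMinus ∘ S.incl) ∘ F) =ᶠ[𝓝 x] S.bdPlus ∘ S.incl := by
    filter_upwards [hF.isOpen_dom.mem_nhds hx] with y hy using hF.bdMinus_eq hy
  have h2 : mfderiv 𝓘(ℝ, ED) 𝓘(ℝ, EQ) ((S.bdMinus ∘ S.incl) ∘ F) x w =
      S.tMinus (S.incl (F x)) (S.tIncl (F x) (mfderiv 𝓘(ℝ, ED) 𝓘(ℝ, ED) F x w)) := by
    rw [mfderiv_comp x hg hd]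
    exact S.mfderiv_bdMinus_incl _ _
  have h3 : (mfderiv 𝓘(ℝ, ED) 𝓘(ℝ, EQ) ((S.bdMinus ∘ S.incl) ∘ F) x w : EQ) =
      mfderiv 𝓘(ℝ, ED) 𝓘(ℝ, EQ) (S.bdPlus ∘ S.incl) x w :=
    DFunLike.congr_fun (show (mfderiv 𝓘(ℝ, ED) 𝓘(ℝ, EQ) ((S.bdMinus ∘ S.incl) ∘ F) x :
      ED →L[ℝ] EQ) = mfderiv 𝓘(ℝ, ED) 𝓘(ℝ, EQ) (S.bdPlus ∘ S.incl) x from h1.mfderiv_eq) w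
  exact h2.symm.trans (h3.trans (S.mfderiv_bdPlus_incl x w))

/-- `K⁰` is invariant under the tangent map of an evolution map. -/
theorem IsEvolutionMap.mfderiv_mem_K0 [FiniteDimensional ℝ ED] [SecondCountableTopology Q]
    (hF : S.IsEvolutionMap F U U') (hS : S.IsHolonomic Δ) {x : D} (hx : x ∈ U)
    {w : TangentSpace 𝓘(ℝ, ED) x} (hw : S.tIncl x w ∈ S.K0 Δ x) :
    S.tIncl (F x) (mfderiv 𝓘(ℝ, ED) 𝓘(ℝ, ED) F x w) ∈ S.K0 Δ (F x) := by
  have h : S.tMinus (S.incl (F x)) (S.tIncl (F x) (mfderiv 𝓘(ℝ, ED) 𝓘(ℝ, ED) F x w)) ∈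
      Δ (S.bdMinus (S.incl (F x))) :=
    mem_distribution_congr Δ (hF.bdMinus_eq hx).symm (hF.tMinus_eq hx w).symm hw.2
  exact ⟨h, hS.tPlus_mem h⟩

/-- The discrete Lagrange-d'Alembert principle in terms of `θ⁺` and `θ⁻`. -/
theorem IsEvolutionMap.thetaPlus_eq_thetaMinus (hF : S.IsEvolutionMap F U U')
    (hS : S.HasLinearConstraints Δ) {x : D} (hx : x ∈ U) {w : TangentSpace 𝓘(ℝ, ED) x}
    (hw : S.tPlus (S.incl x) (S.tIncl x w) ∈ Δ (S.bdPlus (S.incl x))) :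
    S.thetaPlus (S.incl x) (S.tIncl x w) = S.thetaMinus (S.incl (F x))
      (S.tIncl (F x) (mfderiv 𝓘(ℝ, ED) 𝓘(ℝ, ED) F x w)) := by
  have key : ∀ {q q' : Q} {v v' : EQ}, q = q' → v = v' →
      (⟨q, v⟩ : TangentBundle 𝓘(ℝ, EQ) Q) = ⟨q', v'⟩ := by
    rintro q _ v _ rfl rfl
    rfl
  -- The variations tested are the plus part of `w` and the minus part of `TF(w)`; they match at the
  -- common point because `T∂⁻(TF(w)) = T∂⁺(w)`.
  have h := (hF.isSolutionPair x hx).2 (S.plusPart (S.incl x) (S.tIncl x w))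
    (S.minusPart (S.incl (F x)) (S.tIncl (F x) (mfderiv 𝓘(ℝ, ED) 𝓘(ℝ, ED) F x w)))
    (by rw [S.tPlus_plusPart, hS.variations_eq]; exact hw)
    (S.tMinus_plusPart _ _) (S.tPlus_minusPart _ _)
    (key (hF.bdMinus_eq hx).symm ((S.tPlus_plusPart _ _).trans
      ((hF.tMinus_eq hx w).symm.trans (S.tMinus_minusPart _ _).symm)))
  rw [thetaPlus_apply, thetaMinus_apply]
  linarith

/-- An evolution map of a holonomic system maps `ω⁺` to `ω⁻`, on the vectors `δv` tangent to the
constraint submanifold such that `T∂⁺(δv) ∈ Δ`. -/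
theorem IsEvolutionMap.omegaMinus_eq_omegaPlus [FiniteDimensional ℝ ED]
    (hF : S.IsEvolutionMap F U U') (hS : S.IsHolonomic Δ) {x : D} (hx : x ∈ U)
    {a b : TangentSpace 𝓘(ℝ, ED) x}
    (ha : S.tPlus (S.incl x) (S.tIncl x a) ∈ Δ (S.bdPlus (S.incl x)))
    (hb : S.tPlus (S.incl x) (S.tIncl x b) ∈ Δ (S.bdPlus (S.incl x))) :
    S.omegaMinus (S.incl (F x)) (S.tIncl (F x) (mfderiv 𝓘(ℝ, ED) 𝓘(ℝ, ED) F x a))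
      (S.tIncl (F x) (mfderiv 𝓘(ℝ, ED) 𝓘(ℝ, ED) F x b)) =
    S.omegaPlus (S.incl x) (S.tIncl x a) (S.tIncl x b) := by
  have hg : ContMDiff 𝓘(ℝ, ED) 𝓘(ℝ, EQ) ∞ (S.bdPlus ∘ S.incl) :=
    S.contMDiff_bdPlus.comp S.contMDiff_incl
  have hincl : ∀ y, MDifferentiableAt 𝓘(ℝ, ED) 𝓘(ℝ, EV) S.incl y := fun y ↦
    S.contMDiff_incl.mdifferentiableAt (by simp)
  have hFd : ∀ y ∈ U, MDifferentiableAt 𝓘(ℝ, ED) 𝓘(ℝ, ED) F y := fun y hy ↦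
    (hF.contMDiffAt hy).mdifferentiableAt (by simp)
  have hFi : ContMDiffAt 𝓘(ℝ, ED) 𝓘(ℝ, EV) ∞ (S.incl ∘ F) x :=
    S.contMDiff_incl.contMDiffAt.comp x (hF.contMDiffAt hx)
  have hTF : ∀ y ∈ U, ∀ w, mfderiv 𝓘(ℝ, ED) 𝓘(ℝ, EV) (S.incl ∘ F) y w =
      S.tIncl (F y) (mfderiv 𝓘(ℝ, ED) 𝓘(ℝ, ED) F y w) := by
    intro y hy w
    rw [mfderiv_comp y (hincl _) (hFd y hy)]
    rfl
  obtain ⟨k, N, ℓ, u, hfr⟩ := exists_isAdaptedFrame hS.isDistribution hS.isInvolutive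
    (S.bdPlus (S.incl x))
  have hsurj := S.surjective_bdPlus_incl x
  obtain ⟨Y, c, hY, hY₀, hYl⟩ := exists_lift_field_chart (hg x) hsurj hfr (w := a)
    (by rwa [mfderiv_bdPlus_incl])
  obtain ⟨Z, d, hZ, hZ₀, hZl⟩ := exists_lift_field_chart (hg x) hsurj hfr (w := b)
    (by rwa [mfderiv_bdPlus_incl])
  set y₀ := extChartAt 𝓘(ℝ, ED) x x with hy₀
  have hα₁ : DifferentiableAt ℝ (pullbackInChart S.thetaPlus S.incl x) y₀ :=
    differentiableAt_pullbackInChart S.contMDiff_incl.contMDiffAt (S.differentiableAt_thetaPlus _)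
  have hα₂ : DifferentiableAt ℝ (pullbackInChart S.thetaMinus (S.incl ∘ F) x) y₀ :=
    differentiableAt_pullbackInChart hFi (S.differentiableAt_thetaMinus _)
  have hf := contDiffAt_chartMap_self (hg x)
  have hf₀ := chartMap_self (E := EQ) (F := ED) (S.bdPlus ∘ S.incl) x
  have hu : u ∈ 𝓝 (chartMap (S.bdPlus ∘ S.incl) x (S.bdPlus (S.incl x)) y₀ : EQ) := by
    rw [show (chartMap (S.bdPlus ∘ S.incl) x (S.bdPlus (S.incl x)) y₀ : EQ) = _ from hf₀]
    exact hfr.isOpen.mem_nhds hfr.mem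
  -- The defect of `F^*θ⁻ = θ⁺` in the chart at `x`. It vanishes on every vector that `∂⁺` sends
  -- into `Δ`, at all points near `x`, so its exterior derivative vanishes on the lifts `Y`, `Z`
  -- that extend `a`, `b`.
  let β : ED → ED →L[ℝ] ℝ :=
    pullbackInChart S.thetaPlus S.incl x - pullbackInChart S.thetaMinus (S.incl ∘ F) x
  have hv : ∀ᶠ y in 𝓝 y₀, ∀ k,
      N (chartMap (S.bdPlus ∘ S.incl) x (S.bdPlus (S.incl x)) y) (ℓ (fderiv ℝ
        (chartMap (S.bdPlus ∘ S.incl) x (S.bdPlus (S.incl x))) y k)) =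
        fderiv ℝ (chartMap (S.bdPlus ∘ S.incl) x (S.bdPlus (S.incl x))) y k →
      β y k = 0 := by
    have hU := hF.isOpen_dom.mem_nhds hx
    filter_upwards [eventually_chartMap (E := EV) hU (hincl x).continuousAt,
      eventually_chartMap (E := EV) hU hFi.continuousAt,
      eventually_chartMap (E := EQ) hU (hg x).continuousAt,
      hf.continuousAt.eventually hu] with y ⟨h1, h2, h3⟩ ⟨_, _, h4⟩ ⟨_, _, h5⟩ h6 k hk
    have hgd : MDifferentiableAt 𝓘(ℝ, ED) 𝓘(ℝ, EQ) (S.bdPlus ∘ S.incl)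
      ((extChartAt 𝓘(ℝ, ED) x).symm y) := hg.mdifferentiableAt (by simp)
    have e := fderiv_chartMap h1 hgd h5 k
    have hmem := (hfr.mem_iff _ h5 h6 _).2
      ((congrArg (fun z ↦ N _ (ℓ z)) e).symm.trans (hk.trans e))
    rw [mfderiv_bdPlus_incl] at hmem
    have h7 := hF.thetaPlus_eq_thetaMinus hS.toHasLinearConstraints h2 hmem
    have h8 := pullbackInChart_apply S.thetaPlus h1 (hincl _) h3 k
    have h9 := pullbackInChart_apply S.thetaMinus h1
      ((hincl _).comp _ (hFd _ h2)) h4 k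
    have h10 := congrArg (S.thetaMinus (S.incl (F ((extChartAt 𝓘(ℝ, ED) x).symm y))))
      (hTF _ h2 (mfderiv 𝓘(ℝ, ED) 𝓘(ℝ, ED) (extChartAt 𝓘(ℝ, ED) x).symm y k))
    exact sub_eq_zero.2 (h8.trans (h7.trans (h10.symm.trans h9.symm)))
  have hmain := fderiv_symm_of_vanishing (hf.of_le ENat.LEInfty.out) (hα₁.sub hα₂) hu
    ((hfr.contDiffOn.contDiffAt (hfr.isOpen.mem_nhds (mem_of_mem_nhds hu))).differentiableAt
      (by simp)) hfr.left_inv (hfr.comm _ (mem_of_mem_nhds hu)) hv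
    (hY.differentiableAt (by simp)) (hZ.differentiableAt (by simp)) hYl hZl
  rw [fderiv_sub hα₁ hα₂] at hmain
  have e1 := dOneForm_mfderiv (θ := S.thetaPlus) S.contMDiff_incl.contMDiffAt
    (S.differentiableAt_thetaPlus _) a b hY₀.symm hZ₀.symm
  have e2 := dOneForm_mfderiv (θ := S.thetaMinus) hFi
    (S.differentiableAt_thetaMinus _) a b hY₀.symm hZ₀.symm
  rw [hTF x hx, hTF x hx] at e2
  refine congrArg Neg.neg (e2.trans (Eq.trans ?_ e1.symm))
  simp only [sub_apply] at hmain
  linarith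

end Evolution

end DCLS

end Systems

end DiscreteMechanics

end

theorem mainTheorem8
    {EQ : Type*} [NormedAddCommGroup EQ] [NormedSpace ℝ EQ] [FiniteDimensional ℝ EQ]
    {Q : Type*} [TopologicalSpace Q] [T2Space Q] [SecondCountableTopology Q]
    [ChartedSpace EQ Q] [IsManifold 𝓘(ℝ, EQ) ∞ Q]
    {EV : Type*} [NormedAddCommGroup EV] [NormedSpace ℝ EV] [FiniteDimensional ℝ EV]
    {V : Type*} [TopologicalSpace V] [T2Space V] [SecondCountableTopology V]
    [ChartedSpace EV V] [IsManifold 𝓘(ℝ, EV) ∞ V]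
    {ED : Type*} [NormedAddCommGroup ED] [NormedSpace ℝ ED] [FiniteDimensional ℝ ED]
    {D : Type*} [TopologicalSpace D] [ChartedSpace ED D] [IsManifold 𝓘(ℝ, ED) ∞ D]
    (S : DiscreteMechanics.DCLS EQ Q EV V ED D) (Δ : ∀ q : Q, Submodule ℝ (TangentSpace 𝓘(ℝ, EQ) q))
    (hS : S.IsHolonomic Δ) (F : D → D) (U U' : Set D) (hF : S.IsEvolutionMap F U U') :
    -- the two forms `ω⁺` and `ω⁻` are equal; their common value is `ω`
    (∀ v δv δw, S.omegaPlus v δv δw = S.omegaMinus v δv δw) ∧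
    -- `K⁰` consists of vectors tangent to the constraint submanifold
    (∀ x, S.K0 Δ x ≤ (S.tIncl x).range) ∧
    -- `K⁰` is `TF` invariant
    (∀ x ∈ U, ∀ δx : TangentSpace 𝓘(ℝ, ED) x, S.tIncl x δx ∈ S.K0 Δ x →
      S.tIncl (F x) (mfderiv 𝓘(ℝ, ED) 𝓘(ℝ, ED) F x δx) ∈ S.K0 Δ (F x)) ∧
    -- `F` preserves `ω` on `K⁰`
    (∀ x ∈ U, ∀ δx δy : TangentSpace 𝓘(ℝ, ED) x,
      S.tIncl x δx ∈ S.K0 Δ x → S.tIncl x δy ∈ S.K0 Δ x →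
      S.omegaPlus (S.incl (F x))
        (S.tIncl (F x) (mfderiv 𝓘(ℝ, ED) 𝓘(ℝ, ED) F x δx))
        (S.tIncl (F x) (mfderiv 𝓘(ℝ, ED) 𝓘(ℝ, ED) F x δy)) =
      S.omegaPlus (S.incl x) (S.tIncl x δx) (S.tIncl x δy)) := by
  refine ⟨S.omegaPlus_eq_omegaMinus hS.closed_sigma, hS.K0_le,
    fun x hx w hw ↦ hF.mfderiv_mem_K0 hS hx hw, fun x hx a b ha hb ↦ ?_⟩
  -- The variational principle compares `ω⁻` at the image with `ω⁺` at the source; closedness of `σ`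
  -- makes them one form.
  rw [S.omegaPlus_eq_omegaMinus hS.closed_sigma (S.incl (F x))]
  exact hF.omegaMinus_eq_omegaPlus hS hx ha.2 hb.2
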